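/- Fix integers $M,N\ge 1$ and let $\|\cdot\|$ and $\operatorname{dist}$ denote the Euclidean norm and distance. For a real $M\times N$ matrix $A$ and $\mathbf{x}\in\mathbb{R}^M$, the pair $(A,\mathbf{x})$ is called badly approximable if $$\inf_{\mathbf{q}\in\mathbb{Z}^N\setminus\{\mathbf{0}\}}\|\mathbf{q}\|^{N/M}\operatorname{dist}(A\mathbf{q}-\mathbf{x},\mathbb{Z}^M)>0 .$$ For $\mathbf{x}\in\mathbb{R}^M$ let $\mathrm{Bad}_{\mathbf{x}}(M,N)$ be the set of real $M\times N$ matrices $A$ such that $(A,\mathbf{x})$ is badly approximable, regarded as a subset of $\mathbb{R}^{MN}$ with its Euclidean metric. For $d\ge 1$, $0<\beta<1/3$ and $S\subseteq\mathbb{R}^d$, the hyperplane $\beta$-absolute game with target $S$ is played as follows. Bob chooses a closed ball $B_1\subseteq\mathbb{R}^d$ of positive radius. For each $i\ge 1$, once $B_i$, of radius $\rho(B_i)$, is chosen, Alice chooses an affine hyperplane $\mathcal{L}_i\subseteq\mathbb{R}^d$ and a number $0<\varepsilon_i\le\beta\rho(B_i)$, and Bob then chooses a closed ball $B_{i+1}\subseteq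 B_i$ with $\rho(B_{i+1})\ge\beta\rho(B_i)$ that is disjoint from the closed $\varepsilon_i$-neighborhood $\{\mathbf{y}:\operatorname{dist}(\mathbf{y},\mathcal{L}_i)\le\varepsilon_i\}$. (As $\beta<1/3$, Bob always has a legal move.) Alice wins if $S\cap\bigcap_i B_i\ne\varnothing$. The set $S$ is hyperplane absolute winning (HAW) if there is $\beta_0\in(0,1/3]$ such that for every $0<\beta<\beta_0$ Alice has a strategy that wins this game regardless of Bob's play. Theorem. For all integers $M,N\ge 1$ and every $\mathbf{x}\in\mathbb{R}^M$, the set $\mathrm{Bad}_{\mathbf{x}}(M,N)\subseteq\mathbb{R}^{MN}$ is HAW. -/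

import Mathlib

namespace AffineForms

/-! ### Badly approximable systems of affine forms -/

/-- The vector `A q - x` of `ℝ^M` (with its Euclidean norm), for an integer vector `q`. -/
noncomputable def affineForm {M N : ℕ} (A : Matrix (Fin M) (Fin N) ℝ)
    (x : EuclideanSpace ℝ (Fin M)) (q : Fin N → ℤ) : EuclideanSpace ℝ (Fin M) :=
  WithLp.toLp 2 (A.mulVec fun j => (q j : ℝ)) - x

/-- The integer lattice `ℤ^M` inside `ℝ^M`. -/
def integerLattice (M : ℕ) : Set (EuclideanSpace ℝ (Fin M)) :=
  Set.range fun p : Fin M → ℤ => WithLp.toLp 2 fun i => (p i : ℝ)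

/-- The Euclidean norm of an integer vector. -/
noncomputable def intNorm {N : ℕ} (q : Fin N → ℤ) : ℝ :=
  ‖(WithLp.toLp 2 fun j => (q j : ℝ) : EuclideanSpace ℝ (Fin N))‖

/-- `Bad(M, N)`: the pairs `(A, x)` such that the infimum over nonzero integer vectors `q` of
`‖q‖^(N/M) * dist(A q - x, ℤ^M)` is positive. (For `M, N ≥ 1` this is the infimum of a nonempty
family of nonnegative reals.) -/
def Bad (M N : ℕ) : Set (Matrix (Fin M) (Fin N) ℝ × EuclideanSpace ℝ (Fin M)) :=
  {P | 0 < ⨅ q : {q : Fin N → ℤ // q ≠ 0},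
    intNorm q.1 ^ ((N : ℝ) / (M : ℝ)) *
      Metric.infDist (affineForm P.1 P.2 q.1) (integerLattice M)}

/-- The slice `Bad_x(M, N)`: the matrices `A` with `(A, x)` badly approximable. -/
def BadSlice (M N : ℕ) (x : EuclideanSpace ℝ (Fin M)) : Set (Matrix (Fin M) (Fin N) ℝ) :=
  {A | (A, x) ∈ Bad M N}

/-- The identification of `ℝ^(MN)` (with its Euclidean norm) with the `M × N` real matrices. -/
def toMatrix {M N : ℕ} (a : EuclideanSpace ℝ (Fin M × Fin N)) : Matrix (Fin M) (Fin N) ℝ :=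
  Matrix.of fun i j => a (i, j)

/-! ### The `k`-dimensional absolute game -/

section Game

variable {E : Type*} [NormedAddCommGroup E] [InnerProductSpace ℝ E]

/-- A move of Bob: a closed ball, given by its center and its positive radius. -/
structure BobBall (E : Type*) where
  center : E
  radius : ℝ
  radius_pos : 0 < radius

/-- The closed ball as a set. -/
def BobBall.toSet (b : BobBall E) : Set E := Metric.closedBall b.center b.radius

/-- A move of Alice: an affine subspace `𝓛` and a number `ε`; she deletes the
`ε`-thickening of `𝓛`. -/
structure AliceMove (E : Type*) [NormedAddCommGroup E] [InnerProductSpace ℝ E] where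
  plane : AffineSubspace ℝ E
  width : ℝ

/-- The deleted set: the points at distance at most `ε` from `𝓛`. -/
def AliceMove.toSet (a : AliceMove E) : Set E := Metric.cthickening a.width (a.plane : Set E)

/-- Alice's answer `a = (𝓛, ε)` to Bob's ball `b` is legal if `𝓛` is a `k`-dimensional affine
subspace and `0 < ε ≤ β ρ(b)`. -/
def AliceLegal (k : ℕ) (β : ℝ) (b : BobBall E) (a : AliceMove E) : Prop :=
  (a.plane : Set E).Nonempty ∧ Module.finrank ℝ a.plane.direction = k ∧
    0 < a.width ∧ a.width ≤ β * b.radius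

/-- Bob's ball `b'` is a legal answer to Alice's move `a`, when his preceding ball was `b`. -/
def BobLegal (β : ℝ) (b : BobBall E) (a : AliceMove E) (b' : BobBall E) : Prop :=
  b'.toSet ⊆ b.toSet ∧ β * b.radius ≤ b'.radius ∧ Disjoint b'.toSet a.toSet

/-- A strategy for Alice: her move as a function of the list of Bob's earlier balls and of
Bob's current ball. -/
abbrev AliceStrategy (E : Type*) [NormedAddCommGroup E] [InnerProductSpace ℝ E] :=
  List (BobBall E) → BobBall E → AliceMove E

/-- Alice's move at stage `i` when she follows `σ` and Bob plays `B 0, B 1, …`. -/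
def AliceStrategy.moveAt (σ : AliceStrategy E) (B : ℕ → BobBall E) (i : ℕ) : AliceMove E :=
  σ ((List.range i).map B) (B i)

/-- `S` is `k`-dimensionally `β`-absolute winning: Alice has a strategy that always plays legally
and such that `S` meets the intersection of Bob's balls, however Bob plays legally against it. -/
def IsBetaAbsoluteWinning (k : ℕ) (β : ℝ) (S : Set E) : Prop :=
  ∃ σ : AliceStrategy E,
    (∀ (past : List (BobBall E)) (b : BobBall E), AliceLegal k β b (σ past b)) ∧
    ∀ B : ℕ → BobBall E,
      (∀ i, BobLegal β (B i) (σ.moveAt B i) (B (i + 1))) →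
        (S ∩ ⋂ i, (B i).toSet).Nonempty

/-- `S` is `k`-dimensionally absolute winning: `k`-dimensionally `β`-absolute winning for all
sufficiently small `β > 0`. The parameter `β` ranges over `(0, 1/3)`, where Bob always has a legal
move for `k < dim E`, so that every legal play goes on forever. -/
def IsAbsoluteWinning (k : ℕ) (S : Set E) : Prop :=
  ∃ β₀ : ℝ, 0 < β₀ ∧ β₀ ≤ 1 / 3 ∧ ∀ β : ℝ, 0 < β → β < β₀ → IsBetaAbsoluteWinning k β S

/-- Hyperplane absolute winning: `(d - 1)`-dimensionally absolute winning, with `d = dim E ≥ 1`. -/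
def IsHAW (S : Set E) : Prop :=
  IsAbsoluteWinning (Module.finrank ℝ E - 1) S

end Game

end AffineForms

/-! Integer pairs (p, q) are viewed through the vectors (T^N (A q + p), -T^(-M) q), time T
corresponding to radius about r / T^(M+N), where r is the radius of Bob's first ball. At the times T
= R^n Alice maintains, at every matrix A of the current ball, that neither A nor its transpose has a
nonzero short integer vector (`LatticeGood`, with thresholds δ and δ').

To pass from T to R T for A: since the transpose has no short vector, Minkowski's theorem confines
all integer vectors that might be short for A at time R T to one subspace V of dimension M
(`exists_subspace_of_dual_good`). The map v ↦ A v₂ + v₁ on V has a determinant that is affine in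
each entry of A and not identically zero. Alice can stay quantitatively away from its zeros, in a
number of stages depending neither on V nor on R (`forces_avoid`, `forces_subspace`). Hence ‖A q +
p‖ is at least a constant times ρ ‖q‖ on V, and for R large a vector short at time R T would already
be short at time T (`forces_latticeGood`). The transpose is treated in the same way.

The affine forms come almost for free: two integer solutions of A q + p ≈ x differ by a short
vector, so on each ball at most one pair (p, q) matters, and deleting one hyperplane neighbourhood
disposes of it (`forces_affine`). The bounds at all scales together give bad approximability
(`mem_badSlice_of_scales`).

Bob may shrink his balls slowly or not at all. Plans are therefore made in terms of windows of
radii, only the last ball of each window being used (`Forces`, `isBetaAbsoluteWinning_of_stages`).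
This works for every β < 1/3. -/

namespace AffineForms

/-! ### Single moves of the game and windows of radii -/

section Moves

variable {E : Type*}

/-- The radius of `b` lies in the `m`-th window `(β ^ (m + 1) * r, β ^ m * r]`. -/
def InWindow (β r : ℝ) (m : ℕ) (b : BobBall E) : Prop :=
  β ^ (m + 1) * r < b.radius ∧ b.radius ≤ β ^ m * r

lemma InWindow.unique {β r : ℝ} (h0 : 0 < β) (h1 : β < 1) (hr : 0 < r) {m n : ℕ} {b : BobBall E}
    (hm : InWindow β r m b) (hn : InWindow β r n b) : m = n := by
  by_contra hne
  rcases lt_or_gt_of_ne hne with h | h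
  · have : β ^ n ≤ β ^ (m + 1) := pow_le_pow_of_le_one h0.le h1.le h
    have := mul_le_mul_of_nonneg_right this hr.le
    linarith [hm.1, hn.2]
  · have : β ^ m ≤ β ^ (n + 1) := pow_le_pow_of_le_one h0.le h1.le h
    have := mul_le_mul_of_nonneg_right this hr.le
    linarith [hm.2, hn.1]

variable [NormedAddCommGroup E]

lemma BobBall.center_mem (b : BobBall E) : b.center ∈ b.toSet :=
  Metric.mem_closedBall_self b.radius_pos.le

lemma BobBall.isClosed (b : BobBall E) : IsClosed b.toSet := Metric.isClosed_closedBall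

variable [InnerProductSpace ℝ E]

lemma BobBall.radius_le_of_subset [Nontrivial E] {b b' : BobBall E} (h : b'.toSet ⊆ b.toSet) :
    b'.radius ≤ b.radius := by
  have h1 := Metric.diam_mono h (Metric.isBounded_closedBall)
  unfold BobBall.toSet at h1
  rw [Metric.diam_closedBall_eq _ b.radius_pos.le, Metric.diam_closedBall_eq _ b'.radius_pos.le] at h1
  linarith

/-- Alice may delete the neighbourhood of the hyperplane `⟪v, y⟫ = t` of the largest legal width. -/
lemma exists_hyperplane_move [FiniteDimensional ℝ E] {β : ℝ} (hβ : 0 < β) (b : BobBall E)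
    {v : E} (hv : v ≠ 0) (t : ℝ) :
    ∃ a : AliceMove E, AliceLegal (Module.finrank ℝ E - 1) β b a ∧
      ∀ b' : BobBall E, Disjoint b'.toSet a.toSet →
        ∀ y ∈ b'.toSet, β * b.radius * ‖v‖ < |inner ℝ v y - t| := by
  have hv' : 0 < ‖v‖ := norm_pos_iff.2 hv
  refine ⟨⟨AffineSubspace.mk' ((t / ‖v‖ ^ 2) • v) (Submodule.span ℝ {v})ᗮ, β * b.radius⟩,
    ⟨⟨_, AffineSubspace.self_mem_mk' _ _⟩, ?_, mul_pos hβ b.radius_pos, le_rfl⟩, ?_⟩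
  · rw [AffineSubspace.direction_mk']
    have := Submodule.finrank_add_finrank_orthogonal (Submodule.span ℝ {v})
    rw [finrank_span_singleton hv] at this
    omega
  · intro b' hd y hy
    have hy' := Set.disjoint_left.1 hd hy
    by_contra! hle
    apply hy'
    refine Metric.mem_cthickening_of_dist_le y (y - ((inner ℝ v y - t) / ‖v‖ ^ 2) • v) _ _ ?_ ?_
    · rw [SetLike.mem_coe, AffineSubspace.mem_mk', Submodule.mem_orthogonal_singleton_iff_inner_right,
        vsub_eq_sub, inner_sub_right, inner_sub_right, inner_smul_right, inner_smul_right,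
        real_inner_self_eq_norm_sq]
      field_simp
      ring
    · rw [dist_eq_norm, sub_sub_cancel, norm_smul, Real.norm_eq_abs, abs_div, abs_of_pos (by positivity : 0 < ‖v‖ ^ 2)]
      rw [div_mul_eq_mul_div, div_le_iff₀ (by positivity)]
      nlinarith

lemma exists_legal_move [FiniteDimensional ℝ E] [Nontrivial E] {β : ℝ} (hβ : 0 < β) (b : BobBall E) :
    ∃ a : AliceMove E, AliceLegal (Module.finrank ℝ E - 1) β b a := by
  obtain ⟨v, hv⟩ := exists_ne (0 : E)
  obtain ⟨a, ha, -⟩ := exists_hyperplane_move hβ b hv 0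
  exact ⟨a, ha⟩

/-- Bob can answer every legal move by a ball of the smallest legal radius. -/
lemma exists_bob_reply [FiniteDimensional ℝ E] [Nontrivial E] {β : ℝ} (hβ : 0 < β) (hβ' : β < 1 / 3)
    {b : BobBall E} {a : AliceMove E} (ha : AliceLegal (Module.finrank ℝ E - 1) β b a) :
    ∃ b' : BobBall E, b'.toSet ⊆ b.toSet ∧ Disjoint b'.toSet a.toSet ∧
      b'.radius = β * b.radius := by
  obtain ⟨⟨z₀, hz₀⟩, hdim, hw0, hw⟩ := ha
  have hpos : 0 < Module.finrank ℝ E := Module.finrank_pos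
  have hne : a.plane.directionᗮ ≠ ⊥ := by
    intro h
    have := Submodule.finrank_add_finrank_orthogonal a.plane.direction
    rw [h, finrank_bot] at this
    omega
  obtain ⟨u, hu, hu0⟩ := Submodule.exists_mem_ne_zero_of_ne_bot hne
  obtain ⟨v, hv, hv1⟩ : ∃ v ∈ a.plane.directionᗮ, ‖v‖ = 1 :=
    ⟨‖u‖⁻¹ • u, Submodule.smul_mem _ _ hu, by
      rw [norm_smul, norm_inv, norm_norm, inv_mul_cancel₀ (norm_ne_zero_iff.2 hu0)]⟩
  -- The unit normal is oriented so that the center lies on its nonnegative side; Bob moves along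
  -- it, away from the plane.
  obtain ⟨w, hw', hw1, hws⟩ : ∃ w ∈ a.plane.directionᗮ, ‖w‖ = 1 ∧ 0 ≤ inner ℝ w (b.center - z₀) := by
    rcases le_total 0 (inner ℝ v (b.center - z₀)) with h | h
    · exact ⟨v, hv, hv1, h⟩
    · exact ⟨-v, neg_mem hv, by rw [norm_neg, hv1], by rw [inner_neg_left]; linarith⟩
  have hρ := b.radius_pos
  refine ⟨⟨b.center + ((1 - β) * b.radius) • w, β * b.radius, by positivity⟩, ?_, ?_, rfl⟩
  · refine Metric.closedBall_subset_closedBall' ?_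
    rw [dist_eq_norm, add_sub_cancel_left, norm_smul, hw1, Real.norm_eq_abs, abs_of_pos (by nlinarith)]
    linarith
  · rw [Set.disjoint_left]
    intro y hy hya
    -- Any value strictly between β ρ and (1 - 2β) ρ works, and β < 1/3 leaves room for one. The
    -- slack above the width allows the closed thickening to be covered by closed balls around
    -- points of the plane.
    set δ := (1 - 3 / 2 * β - 1 / 6) * b.radius with hδ
    have h1 : a.width < δ := by rw [hδ]; nlinarith
    have h2 := Metric.cthickening_subset_iUnion_closedBall_of_lt _ (hw0.trans h1) h1 hya
    simp only [Set.mem_iUnion, exists_prop] at h2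
    obtain ⟨z, hz, hyz⟩ := h2
    rw [mem_closedBall_iff_norm] at hyz
    have hy' : ‖y - (b.center + ((1 - β) * b.radius) • w)‖ ≤ β * b.radius :=
      mem_closedBall_iff_norm.1 hy
    have h3 : inner ℝ w (z - z₀) = 0 := by
      have := (Submodule.mem_orthogonal' _ _).1 hw' (z - z₀) (AffineSubspace.vsub_mem_direction hz hz₀)
      exact this
    have h4 : inner ℝ w (y - z) = inner ℝ w (y - (b.center + ((1 - β) * b.radius) • w)) +
        inner ℝ w (b.center - z₀) + (1 - β) * b.radius := by
      have : y - z = (y - (b.center + ((1 - β) * b.radius) • w)) + (b.center - z₀) +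
        ((1 - β) * b.radius) • w - (z - z₀) := by abel
      rw [this, inner_sub_right, inner_add_right, inner_add_right, inner_smul_right,
        real_inner_self_eq_norm_sq, hw1, h3]
      ring
    have h5 : inner ℝ w (y - z) ≤ δ := by
      have := real_inner_le_norm w (y - z)
      rw [hw1, one_mul] at this
      linarith
    have h6 := abs_le.1 (abs_real_inner_le_norm w (y - (b.center + ((1 - β) * b.radius) • w)))
    rw [hw1, one_mul] at h6
    rw [hδ] at h5
    nlinarith [h6.1]

/-- The last ball of each window: if the radii of a play tend to zero and shrink by a factor at
least `β` at each step, there are indices `j m` such that `B (j m)` is in the `m`-th window and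
`B (j m + 1)` is in the next one or beyond. -/
lemma exists_last_in_window [Nontrivial E] {β : ℝ} (hβ : 0 < β) (hβ' : β < 1) (B : ℕ → BobBall E)
    (h : ∀ i, (B (i + 1)).toSet ⊆ (B i).toSet) (hr : ∀ i, β * (B i).radius ≤ (B (i + 1)).radius)
    (hlim : ∀ s > 0, ∃ i, (B i).radius < s) :
    ∃ j : ℕ → ℕ, ∀ m, InWindow β (B 0).radius m (B (j m)) ∧ j m + 1 ≤ j (m + 1) := by
  classical
  have hr0 := (B 0).radius_pos
  have hex : ∀ m, ∃ i, (B i).radius ≤ β ^ (m + 1) * (B 0).radius := fun m =>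
    (hlim _ (by positivity)).imp fun i hi => hi.le
  have hanti : Antitone fun i => (B i).radius :=
    antitone_nat_of_succ_le fun i => BobBall.radius_le_of_subset (h i)
  -- `t m` is the first index below window m, so `t m - 1` is the last index in it.
  set t : ℕ → ℕ := fun m => Nat.find (hex m) with ht
  have ht1 : ∀ m, (B (t m)).radius ≤ β ^ (m + 1) * (B 0).radius := fun m => Nat.find_spec (hex m)
  have ht0 : ∀ m, 0 < t m := by
    intro m
    rw [Nat.pos_iff_ne_zero]
    intro h0
    have h1 := ht1 m
    rw [h0] at h1
    have : β ^ (m + 1) < 1 := pow_lt_one₀ hβ.le hβ' (Nat.succ_ne_zero m)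
    nlinarith
  have ht2 : ∀ m, β ^ (m + 1) * (B 0).radius < (B (t m - 1)).radius := fun m => by
    have := Nat.find_min (hex m) (m := t m - 1) (Nat.sub_lt (ht0 m) one_pos)
    exact not_le.1 this
  -- One step costs at most a factor β, so no window is skipped.
  have hlt : ∀ m, t m < t (m + 1) := by
    intro m
    by_contra! hle
    have h1 : (B (t m)).radius ≤ (B (t (m + 1))).radius := hanti hle
    have h2 := hr (t m - 1)
    rw [Nat.sub_add_cancel (ht0 m)] at h2
    have h3 := ht1 (m + 1)
    have h4 := mul_lt_mul_of_pos_left (ht2 m) hβ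
    have e : β ^ (m + 1 + 1) = β * β ^ (m + 1) := pow_succ' _ _
    rw [e] at h3
    nlinarith
  refine ⟨fun m => t m - 1, fun m => ⟨⟨ht2 m, ?_⟩, ?_⟩⟩
  · cases m with
    | zero => simpa using hanti (Nat.zero_le _)
    | succ m => exact (hanti (Nat.le_sub_one_of_lt (hlt m))).trans (ht1 m)
  · have := hlt m
    have := ht0 m
    show t m - 1 + 1 ≤ t (m + 1) - 1
    omega

end Moves

/-! ### Goals that Alice can force in finitely many windows -/

section Forces

variable {E : Type*} [NormedAddCommGroup E] [InnerProductSpace ℝ E]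

/-- From Bob's ball `b`, of radius in the `m`-th window, Alice can make sure that Bob's ball `k`
stages later satisfies `Φ`. At each stage Bob passes to the next window. -/
def Forces (β r : ℝ) (Φ : BobBall E → Prop) : ℕ → ℕ → BobBall E → Prop
  | 0, _, b => Φ b
  | k + 1, m, b => ∃ a : AliceMove E, AliceLegal (Module.finrank ℝ E - 1) β b a ∧
      ∀ b' : BobBall E, b'.toSet ⊆ b.toSet → Disjoint b'.toSet a.toSet →
        InWindow β r (m + 1) b' → Forces β r Φ k (m + 1) b'

/-- Plans compose and their lengths add; the second plan is chosen only when the ball reached by the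
first is known. -/
lemma Forces.bind {β r : ℝ} {Φ Ψ : BobBall E → Prop} {k l m : ℕ} {b : BobBall E}
    (hw : InWindow β r m b) (h : Forces β r Φ k m b)
    (hΦ : ∀ b' : BobBall E, b'.toSet ⊆ b.toSet → InWindow β r (m + k) b' → Φ b' →
      Forces β r Ψ l (m + k) b') :
    Forces β r Ψ (k + l) m b := by
  induction k generalizing m b with
  | zero => simpa using hΦ b subset_rfl hw h
  | succ k ih =>
    obtain ⟨a, ha, h⟩ := h
    rw [Nat.succ_add]
    refine ⟨a, ha, fun b' hb hd hw' => ih hw' (h b' hb hd hw') fun b'' hb' hw'' hΦ' => ?_⟩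
    have e : m + 1 + k = m + (k + 1) := by ring
    rw [e] at hw'' ⊢
    exact hΦ b'' (hb'.trans hb) hw'' hΦ'

lemma Forces.mono {β r : ℝ} {Φ Ψ : BobBall E → Prop} {k m : ℕ} {b : BobBall E}
    (hw : InWindow β r m b) (h : Forces β r Φ k m b)
    (hΦ : ∀ b' : BobBall E, b'.toSet ⊆ b.toSet → InWindow β r (m + k) b' → Φ b' → Ψ b') :
    Forces β r Ψ k m b :=
  Forces.bind (l := 0) hw h hΦ

/-- Alice may wait by playing arbitrary legal moves. -/
lemma forces_of_subset [FiniteDimensional ℝ E] [Nontrivial E] {β : ℝ} (hβ : 0 < β) {r : ℝ}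
    {Φ : BobBall E → Prop} (k m : ℕ) (b : BobBall E)
    (hΦ : ∀ b' : BobBall E, b'.toSet ⊆ b.toSet → Φ b') : Forces β r Φ k m b := by
  induction k generalizing m b with
  | zero => exact hΦ b subset_rfl
  | succ k ih =>
    obtain ⟨a, ha⟩ := exists_legal_move hβ b
    exact ⟨a, ha, fun b' hb _ _ => ih _ _ fun b'' hb' => hΦ b'' (hb'.trans hb)⟩

/-- A property inherited by smaller balls can be forced later than needed. -/
lemma Forces.of_le [FiniteDimensional ℝ E] [Nontrivial E] {β : ℝ} (hβ : 0 < β) {r : ℝ}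
    {Φ : BobBall E → Prop} (hΦ : ∀ b b' : BobBall E, b'.toSet ⊆ b.toSet → Φ b → Φ b')
    {k l m : ℕ} (hkl : k ≤ l) {b : BobBall E} (hw : InWindow β r m b) (h : Forces β r Φ k m b) :
    Forces β r Φ l m b := by
  obtain ⟨j, rfl⟩ := Nat.exists_eq_add_of_le hkl
  exact h.bind hw fun b' _ _ hb' => forces_of_subset hβ _ _ _ fun b'' hs => hΦ b' b'' hs hb'

end Forces

/-! ### From forcing plans to winning strategies -/

section Winning

variable {E : Type*} [NormedAddCommGroup E] [InnerProductSpace ℝ E] [FiniteDimensional ℝ E]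

lemma iInter_nonempty_of_antitone (B : ℕ → BobBall E) (h : ∀ i, (B (i + 1)).toSet ⊆ (B i).toSet) :
    (⋂ i, (B i).toSet).Nonempty := by
  have := FiniteDimensional.proper_real E
  exact IsCompact.nonempty_iInter_of_sequence_nonempty_isCompact_isClosed _ h
    (fun i => ⟨_, (B i).center_mem⟩) (isCompact_closedBall _ _) fun i => (B i).isClosed

/-- Nested balls whose radii stay above `s` contain a common ball of radius `s`. -/
lemma exists_ball_subset_of_radius_ge (B : ℕ → BobBall E)
    (h : ∀ i, (B (i + 1)).toSet ⊆ (B i).toSet) {s : ℝ} (hs : 0 < s) (hr : ∀ i, s ≤ (B i).radius) :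
    ∃ b : BobBall E, ∀ i, b.toSet ⊆ (B i).toSet := by
  have := FiniteDimensional.proper_real E
  have hanti : Antitone fun i => (B i).toSet := antitone_nat_of_succ_le h
  have hc : ∀ i, (B i).center ∈ (B 0).toSet := fun i => hanti (Nat.zero_le i) (B i).center_mem
  obtain ⟨c, -, φ, hφ, hlim⟩ := (isCompact_closedBall (B 0).center (B 0).radius).tendsto_subseq hc
  -- The common ball is centered at a limit point of the centers: each of its points is a limit of
  -- translates lying in `B (φ n)`, hence eventually in the closed ball `B i`.
  refine ⟨⟨c, s, hs⟩, fun i y hy => ?_⟩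
  have hlim' : Filter.Tendsto (fun n => y + ((B (φ n)).center - c)) Filter.atTop (nhds y) := by
    have := (hlim.sub_const c).const_add y
    simpa using this
  refine (B i).isClosed.mem_of_tendsto hlim' ?_
  filter_upwards [Filter.eventually_ge_atTop i] with n hn
  refine hanti (hn.trans (hφ.id_le n)) ?_
  have hy' : ‖y - c‖ ≤ s := mem_closedBall_iff_norm.1 hy
  refine mem_closedBall_iff_norm.2 ?_
  refine le_trans (le_of_eq ?_) (hy'.trans (hr _))
  congr 1
  abel

variable [Nontrivial E]

/-- A stage-by-stage winning strategy, in the windows of radii, gives a winning strategy. -/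
theorem isBetaAbsoluteWinning_of_stages {β : ℝ} (hβ : 0 < β) (hβ' : β < 1 / 3) {S : Set E}
    (Φ : BobBall E → ℕ → BobBall E → Prop)
    (init : ∀ b₀ b : BobBall E, b.toSet ⊆ b₀.toSet → InWindow β b₀.radius 0 b → Φ b₀ 0 b)
    (step : ∀ b₀ m b, InWindow β b₀.radius m b → Φ b₀ m b →
      Forces β b₀.radius (Φ b₀ (m + 1)) 1 m b)
    (win : ∀ b₀ (C : ℕ → BobBall E), (∀ m, Φ b₀ m (C m)) → ∀ y, (∀ m, y ∈ (C m).toSet) → y ∈ S) :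
    IsBetaAbsoluteWinning (Module.finrank ℝ E - 1) β S := by
  classical
  have hβ1 : β < 1 := by linarith
  have : Nonempty (AliceMove E) := ⟨⟨⊤, 0⟩⟩
  choose! A hA hA' using step
  choose dummy hdummy using fun b : BobBall E => exists_legal_move hβ b
  -- Needed for plays whose radii do not tend to zero. Simulating a game from b₀, in which Bob
  -- always takes the smallest radius, produces a point of S in b₀.
  have dense : ∀ b₀ : BobBall E, (S ∩ b₀.toSet).Nonempty := by
    intro b₀
    have hr0 := b₀.radius_pos
    have next : ∀ (m : ℕ) (b : {b : BobBall E // b.radius = β ^ m * b₀.radius ∧ Φ b₀ m b}),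
        ∃ b' : {b : BobBall E // b.radius = β ^ (m + 1) * b₀.radius ∧ Φ b₀ (m + 1) b},
          b'.1.toSet ⊆ b.1.toSet := by
      have win_of : ∀ (m : ℕ) (b : BobBall E), b.radius = β ^ m * b₀.radius →
          InWindow β b₀.radius m b := by
        intro m b hb
        refine ⟨?_, hb.le⟩
        rw [hb, pow_succ]
        have : 0 < β ^ m * b₀.radius := by positivity
        nlinarith
      rintro m ⟨b, hb, hΦ⟩
      obtain ⟨b', hs, hd, hb'⟩ := exists_bob_reply hβ hβ' (hA b₀ m b (win_of m b hb) hΦ)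
      have e : b'.radius = β ^ (m + 1) * b₀.radius := by rw [hb', hb, pow_succ]; ring
      exact ⟨⟨b', e, hA' b₀ m b (win_of m b hb) hΦ b' hs hd (win_of _ _ e)⟩, hs⟩
    choose nx hnx using next
    let C : ∀ m : ℕ, {b : BobBall E // b.radius = β ^ m * b₀.radius ∧ Φ b₀ m b} := fun m =>
      Nat.rec ⟨b₀, by simp, init b₀ b₀ subset_rfl ⟨by simp; nlinarith, by simp⟩⟩
        (fun m b => nx m b) m
    obtain ⟨y, hy⟩ := iInter_nonempty_of_antitone (fun m => (C m).1) fun m => hnx m (C m)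
    rw [Set.mem_iInter] at hy
    exact ⟨y, win b₀ (fun m => (C m).1) (fun m => (C m).2.2) y hy, hy 0⟩
  -- Bob's first ball is the head of the history, or `b` itself when the history is empty. The stage
  -- is read off from the radius, as the windows are disjoint.
  let σ : AliceStrategy E := fun past b =>
    if h : ∃ n, InWindow β (past.head?.getD b).radius n b ∧ Φ (past.head?.getD b) n b
    then A (past.head?.getD b) h.choose b else dummy b
  have hσ : ∀ (B : ℕ → BobBall E) i n, InWindow β (B 0).radius n (B i) → Φ (B 0) n (B i) →
      σ.moveAt B i = A (B 0) n (B i) := by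
    intro B i n hw hΦ
    have hhead : ((List.range i).map B).head?.getD (B i) = B 0 := by
      cases i with
      | zero => simp
      | succ i => simp [List.range_succ_eq_map]
    have hex : ∃ n, InWindow β (B 0).radius n (B i) ∧ Φ (B 0) n (B i) := ⟨n, hw, hΦ⟩
    have : σ.moveAt B i = A (B 0) hex.choose (B i) := by
      simp only [AliceStrategy.moveAt, σ, hhead]
      rw [dif_pos hex]
    rw [this, InWindow.unique hβ hβ1 (B 0).radius_pos hex.choose_spec.1 hw]
  refine ⟨σ, fun past b => ?_, fun B hB => ?_⟩
  · by_cases h : ∃ n, InWindow β (past.head?.getD b).radius n b ∧ Φ (past.head?.getD b) n b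
    · simp only [σ, dif_pos h]
      exact hA _ _ _ h.choose_spec.1 h.choose_spec.2
    · simp only [σ, dif_neg h]
      exact hdummy b
  · have hsub : ∀ i, (B (i + 1)).toSet ⊆ (B i).toSet := fun i => (hB i).1
    have hanti : Antitone fun i => (B i).toSet := antitone_nat_of_succ_le hsub
    by_cases hlim : ∀ s > 0, ∃ i, (B i).radius < s
    · obtain ⟨j, hj⟩ := exists_last_in_window hβ hβ1 B hsub (fun i => (hB i).2.1) hlim
      have hΦ : ∀ m, Φ (B 0) m (B (j m)) := by
        intro m
        induction m with
        | zero => exact init _ _ (hanti (Nat.zero_le _)) (hj 0).1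
        | succ m ih =>
          have h1 := hA' _ _ _ (hj m).1 ih (B (j (m + 1)))
          rw [← hσ B _ m (hj m).1 ih] at h1
          refine h1 (hanti (by have := (hj m).2; omega)) ?_ (hj (m + 1)).1
          -- Bob may play further balls before `j (m + 1)`, but they all lie in his direct answer to
          -- the move at `j m` and so inherit its disjointness.
          exact (hB (j m)).2.2.mono_left (hanti (hj m).2)
      obtain ⟨y, hy⟩ := iInter_nonempty_of_antitone B hsub
      exact ⟨y, win (B 0) (fun m => B (j m)) hΦ y fun m => Set.mem_iInter.1 hy _, hy⟩
    · push Not at hlim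
      obtain ⟨s, hs, hle⟩ := hlim
      obtain ⟨b, hb⟩ := exists_ball_subset_of_radius_ge B hsub hs hle
      obtain ⟨y, hyS, hy⟩ := dense b
      exact ⟨y, hyS, Set.mem_iInter.2 fun i => hb i hy⟩

/-- A winning strategy from properties that Alice can force one after the other, every `K`
stages. -/
theorem isBetaAbsoluteWinning_of_forces {β : ℝ} (hβ : 0 < β) (hβ' : β < 1 / 3) {S : Set E}
    (h : ∀ b₀ : BobBall E, ∃ (K : ℕ) (G : ℕ → BobBall E → Prop), 0 < K ∧
      (∀ b : BobBall E, b.toSet ⊆ b₀.toSet → InWindow β b₀.radius 0 b → G 0 b) ∧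
      (∀ n b, InWindow β b₀.radius (n * K) b → G n b →
        Forces β b₀.radius (G (n + 1)) K (n * K) b) ∧
      ∀ C : ℕ → BobBall E, (∀ n, G n (C n)) → ∀ y, (∀ n, y ∈ (C n).toSet) → y ∈ S) :
    IsBetaAbsoluteWinning (Module.finrank ℝ E - 1) β S := by
  choose K G hK init step win using h
  -- With m = n K + k, the invariant stores what remains of the current plan, K - k stages, and
  -- retains G n itself at the start of a block.
  refine isBetaAbsoluteWinning_of_stages hβ hβ' (fun b₀ m b =>
    ∃ n k, n * K b₀ + k = m ∧ k < K b₀ ∧ (k = 0 → G b₀ n b) ∧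
      Forces β b₀.radius (G b₀ (n + 1)) (K b₀ - k) m b) ?_ ?_ ?_
  · intro b₀ b hb hw
    exact ⟨0, 0, by simp, hK b₀, fun _ => init b₀ b hb hw, by
      simpa using step b₀ 0 b (by simpa using hw) (init b₀ b hb hw)⟩
  · rintro b₀ m b hw ⟨n, k, rfl, hk, -, hF⟩
    obtain ⟨l, hl⟩ : ∃ l, K b₀ - k = l + 1 := ⟨K b₀ - k - 1, by omega⟩
    rw [hl] at hF
    obtain ⟨a, ha, hF⟩ := hF
    refine ⟨a, ha, fun b' hs hd hw' => ?_⟩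
    have hF' := hF b' hs hd hw'
    by_cases hl0 : l = 0
    · subst hl0
      have hG : G b₀ (n + 1) b' := hF'
      have e : n * K b₀ + k + 1 = (n + 1) * K b₀ := by rw [Nat.add_mul]; omega
      rw [e] at hw' ⊢
      exact ⟨n + 1, 0, rfl, hK b₀, fun _ => hG, by simpa using step b₀ (n + 1) b' hw' hG⟩
    · exact ⟨n, k + 1, rfl, by omega, by simp, by
        rw [show K b₀ - (k + 1) = l by omega]; exact hF'⟩
  · intro b₀ C hC y hy
    refine win b₀ (fun n => C (n * K b₀)) (fun n => ?_) y fun n => hy _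
    obtain ⟨n', k, e, hk, hG, -⟩ := hC (n * K b₀)
    have hn : n' = n := by
      have h1 := congrArg (· / K b₀) e
      rw [Nat.mul_comm, Nat.mul_add_div (hK b₀), Nat.div_eq_of_lt hk, Nat.mul_div_cancel _ (hK b₀)] at h1
      simpa using h1
    subst hn
    exact hG (by omega)

end Winning

open Function Matrix

/-! ### Estimates for functions affine in each variable -/

section MultiAffine

variable {ι : Type*} [DecidableEq ι]

/-- Functions of several real variables that are affine in each variable separately. -/
def MultiAffine (f : (ι → ℝ) → ℝ) : Prop :=
  ∀ a i t, f (update a i t) = f (update a i 0) + t * (f (update a i 1) - f (update a i 0))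

/-- The partial derivative of a multi-affine function, as a difference. -/
def partialDiff (i : ι) (f : (ι → ℝ) → ℝ) (a : ι → ℝ) : ℝ := f (update a i 1) - f (update a i 0)

/-- The closed cube with center `c` and half side `r`. -/
def cube (c : ι → ℝ) (r : ℝ) : Set (ι → ℝ) := {a | ∀ i, |a i - c i| ≤ r}

lemma update_mem_cube {c a : ι → ℝ} {r : ℝ} (ha : a ∈ cube c r) {i : ι} {t : ℝ}
    (ht : |t - c i| ≤ r) : update a i t ∈ cube c r := by
  intro j
  by_cases h : j = i
  · subst h; simpa using ht
  · simpa [h] using ha j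

lemma piecewise_mem_cube {c a a' : ι → ℝ} {r : ℝ} (ha : a ∈ cube c r) (ha' : a' ∈ cube c r)
    (s : Finset ι) : s.piecewise a' a ∈ cube c r := by
  intro j
  by_cases h : j ∈ s
  · simpa [h] using ha' j
  · simpa [h] using ha j

lemma MultiAffine.update_sub {f : (ι → ℝ) → ℝ} (hf : MultiAffine f) (a : ι → ℝ) (i : ι) (s t : ℝ) :
    f (update a i s) - f (update a i t) = (s - t) * partialDiff i f a := by
  rw [hf a i s, hf a i t, partialDiff]; ring

lemma partialDiff_comm (i j : ι) (f : (ι → ℝ) → ℝ) (a : ι → ℝ) :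
    partialDiff i (partialDiff j f) a = partialDiff j (partialDiff i f) a := by
  by_cases h : i = j
  · rw [h]
  · simp only [partialDiff, update_comm h]; ring

lemma partialDiff_self (i : ι) (f : (ι → ℝ) → ℝ) (a : ι → ℝ) :
    partialDiff i (partialDiff i f) a = 0 := by
  simp [partialDiff]

lemma MultiAffine.partialDiff {f : (ι → ℝ) → ℝ} (hf : MultiAffine f) (j : ι) :
    MultiAffine (partialDiff j f) := by
  intro a i t
  by_cases h : i = j
  · subst h; simp [AffineForms.partialDiff]
  · simp only [AffineForms.partialDiff, update_comm h]
    rw [hf (update a j 1) i t, hf (update a j 0) i t]; ring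

/-- The difference in direction i does not depend on the i-th coordinate, so it is read off from the
two opposite faces of the cube, at distance 2 r. -/
lemma MultiAffine.abs_partialDiff_le {f : (ι → ℝ) → ℝ} (hf : MultiAffine f) {c : ι → ℝ} {r K : ℝ}
    (hr : 0 < r) (h : ∀ a ∈ cube c r, |f a| ≤ K) (i : ι) {a : ι → ℝ} (ha : a ∈ cube c r) :
    |AffineForms.partialDiff i f a| ≤ K / r := by
  have h1 := hf.update_sub a i (c i + r) (c i - r)
  have h2 := h _ (update_mem_cube ha (i := i) (t := c i + r) (by simp [abs_of_pos hr]))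
  have h3 := h _ (update_mem_cube ha (i := i) (t := c i - r) (by simp [abs_of_pos hr]))
  have h4 : |2 * r * AffineForms.partialDiff i f a| ≤ 2 * K := by
    rw [show 2 * r * AffineForms.partialDiff i f a =
      (c i + r - (c i - r)) * AffineForms.partialDiff i f a by ring, ← h1]
    exact (abs_sub _ _).trans (by linarith)
  rw [abs_mul, abs_of_pos (by positivity)] at h4
  rw [le_div_iff₀ hr]
  linarith

/-- The coordinates are changed one at a time, each change being exactly linear. -/
lemma MultiAffine.abs_piecewise_sub_le {f : (ι → ℝ) → ℝ} (hf : MultiAffine f) {c : ι → ℝ}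
    {r L h : ℝ} (hD : ∀ i, ∀ a ∈ cube c r, |AffineForms.partialDiff i f a| ≤ L)
    {a a' : ι → ℝ} (ha : a ∈ cube c r) (ha' : a' ∈ cube c r) (hh : ∀ i, |a' i - a i| ≤ h)
    (s : Finset ι) : |f (s.piecewise a' a) - f a| ≤ s.card * (h * L) := by
  induction s using Finset.induction_on with
  | empty => simp
  | insert j s hj ih =>
    rw [Finset.piecewise_insert, Finset.card_insert_of_notMem hj]
    have h1 := hf.update_sub (s.piecewise a' a) j (a' j) (a j)
    have h2 : update (s.piecewise a' a) j (a j) = s.piecewise a' a := by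
      rw [update_eq_self_iff]; simp [hj]
    rw [h2] at h1
    have h3 : |f (update (s.piecewise a' a) j (a' j)) - f (s.piecewise a' a)| ≤ h * L := by
      rw [h1, abs_mul]
      exact mul_le_mul (hh j) (hD j _ (piecewise_mem_cube ha ha' s)) (abs_nonneg _)
        ((abs_nonneg _).trans (hh j))
    have h4 := abs_sub_le (f (update (s.piecewise a' a) j (a' j))) (f (s.piecewise a' a)) (f a)
    push_cast
    linarith

/-- Second-order Taylor estimate: when a coordinate is changed, its slope at the intermediate point
differs from that at `a` by the first-order estimate applied to the slope. -/
lemma MultiAffine.abs_piecewise_sub_sub_le {f : (ι → ℝ) → ℝ} (hf : MultiAffine f) {c : ι → ℝ}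
    {r L h : ℝ} (hL : 0 ≤ L) (n : ℕ)
    (hD : ∀ i j, ∀ a ∈ cube c r, |AffineForms.partialDiff j (AffineForms.partialDiff i f) a| ≤ L)
    {a a' : ι → ℝ} (ha : a ∈ cube c r) (ha' : a' ∈ cube c r) (hh : ∀ i, |a' i - a i| ≤ h)
    (s : Finset ι) (hs : s.card ≤ n) :
    |f (s.piecewise a' a) - f a - ∑ i ∈ s, (a' i - a i) * AffineForms.partialDiff i f a| ≤
      s.card * (h * (n * (h * L))) := by
  induction s using Finset.induction_on with
  | empty => simp
  | insert j s hj ih =>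
    rw [Finset.card_insert_of_notMem hj] at hs
    rw [Finset.piecewise_insert, Finset.card_insert_of_notMem hj, Finset.sum_insert hj]
    have h1 := hf.update_sub (s.piecewise a' a) j (a' j) (a j)
    have h2 : update (s.piecewise a' a) j (a j) = s.piecewise a' a := by
      rw [update_eq_self_iff]; simp [hj]
    rw [h2] at h1
    have hh0 : 0 ≤ h := (abs_nonneg _).trans (hh j)
    have h5 : |AffineForms.partialDiff j f (s.piecewise a' a) - AffineForms.partialDiff j f a| ≤
        n * (h * L) := by
      refine ((hf.partialDiff j).abs_piecewise_sub_le (hD j) ha ha' hh s).trans ?_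
      gcongr
      omega
    have h3 : |(a' j - a j) * (AffineForms.partialDiff j f (s.piecewise a' a) -
        AffineForms.partialDiff j f a)| ≤ h * (n * (h * L)) := by
      rw [abs_mul]
      exact mul_le_mul (hh j) h5 (abs_nonneg _) hh0
    have h4 := ih (by omega)
    have h6 := abs_add_le ((a' j - a j) * (AffineForms.partialDiff j f (s.piecewise a' a) -
        AffineForms.partialDiff j f a))
      (f (s.piecewise a' a) - f a - ∑ i ∈ s, (a' i - a i) * AffineForms.partialDiff i f a)
    have e : f (update (s.piecewise a' a) j (a' j)) - f a - ((a' j - a j) *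
        AffineForms.partialDiff j f a + ∑ i ∈ s, (a' i - a i) * AffineForms.partialDiff i f a) =
      (a' j - a j) * (AffineForms.partialDiff j f (s.piecewise a' a) -
        AffineForms.partialDiff j f a) +
      (f (s.piecewise a' a) - f a - ∑ i ∈ s, (a' i - a i) * AffineForms.partialDiff i f a) := by
      linear_combination h1
    rw [e]
    push_cast
    linarith

/-- A multi-affine function vanishing on a cube vanishes everywhere. -/
lemma MultiAffine.eq_zero_of_cube [Fintype ι] {f : (ι → ℝ) → ℝ} (hf : MultiAffine f) {c : ι → ℝ}
    {r : ℝ} (hr : 0 < r) (h : ∀ a ∈ cube c r, f a = 0) (a : ι → ℝ) : f a = 0 := by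
  have key : ∀ s : Finset ι, ∀ a ∈ cube c r, ∀ a', f (s.piecewise a' a) = 0 := by
    intro s
    induction s using Finset.induction_on with
    | empty => intro a ha a'; simpa using h a ha
    | insert j s hj ih =>
      intro a ha a'
      have hz : ∀ t, |t - c j| ≤ r → f (update (s.piecewise a' a) j t) = 0 := by
        intro t ht
        rw [Finset.update_piecewise_of_notMem _ _ _ hj]
        exact ih _ (update_mem_cube ha ht) a'
      rw [Finset.piecewise_insert]
      -- Vanishing at two values of the j-th coordinate kills the slope, so that coordinate may
      -- leave the cube.
      have h1 := hf.update_sub (s.piecewise a' a) j (c j + r) (c j)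
      rw [hz (c j + r) (by simp [abs_of_pos hr]), hz (c j) (by simp [hr.le])] at h1
      have h2 : AffineForms.partialDiff j f (s.piecewise a' a) = 0 := by
        have h3 : r * AffineForms.partialDiff j f (s.piecewise a' a) = 0 := by linarith
        exact (mul_eq_zero.1 h3).resolve_left hr.ne'
      have h4 := hf.update_sub (s.piecewise a' a) j (a' j) (c j)
      rw [h2, mul_zero, hz (c j) (by simp [hr.le])] at h4
      linarith
  have := key Finset.univ c (fun i => by simp [hr.le]) a
  simpa using this

end MultiAffine

/-! ### Staying away from the zeros of a multi-affine function -/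

section Avoid

variable {ι : Type*}

lemma mem_cube_of_mem_toSet [Fintype ι] {b : BobBall (EuclideanSpace ℝ ι)} {y : EuclideanSpace ℝ ι}
    (hy : y ∈ b.toSet) : y.ofLp ∈ cube b.center.ofLp b.radius := by
  intro i
  have h := EuclideanSpace.norm_eq (y - b.center)
  have h1 : ‖y - b.center‖ ≤ b.radius := mem_closedBall_iff_norm.1 hy
  exact (PiLp.norm_apply_le (y - b.center) i).trans h1

lemma cube_mono {c : ι → ℝ} {r r' : ℝ} (h : r ≤ r') : cube c r ⊆ cube c r' :=
  fun _ ha i => (ha i).trans h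

variable [DecidableEq ι] [Fintype ι] [Nonempty ι]

/-- Alice can keep away from the zeros of a multi-affine function, in a bounded number of stages
and with a bound uniform in the function. -/
theorem forces_avoid {β : ℝ} (hβ : 0 < β) (hβ1 : β < 1) (n : ℕ) : ∀ K : ℝ, 0 < K →
    ∃ (k : ℕ) (c : ℝ), 0 < c ∧ ∀ (r : ℝ) (f : (ι → ℝ) → ℝ) (s : Finset ι), 0 < r → s.card ≤ n →
      MultiAffine f → (∀ i, i ∉ s → ∀ a, partialDiff i f a = 0) →
      ∀ (m : ℕ) (b : BobBall (EuclideanSpace ℝ ι)) (F : ℝ), InWindow β r m b → 0 ≤ F →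
        (∀ a ∈ cube b.center.ofLp (2 * b.radius), |f a| ≤ K * F) →
        (∃ a ∈ cube b.center.ofLp (2 * b.radius), F ≤ |f a|) →
        Forces β r (fun b' => ∀ y ∈ b'.toSet, c * F ≤ |f y.ofLp|) k m b := by
  set d : ℝ := (Fintype.card ι : ℝ) with hd
  have hd0 : 0 < d := by rw [hd]; exact_mod_cast Fintype.card_pos
  -- Two points of the cube differ by at most 4 ρ in each of d coordinates, so slopes at most τ F /
  -- ρ change f by at most F / 2.
  set τ : ℝ := 1 / (8 * d) with hτ
  have hτ0 : 0 < τ := by positivity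
  have flat : ∀ (f : (ι → ℝ) → ℝ), MultiAffine f → ∀ (b : BobBall (EuclideanSpace ℝ ι)) (F : ℝ),
      0 ≤ F → (∃ a ∈ cube b.center.ofLp (2 * b.radius), F ≤ |f a|) →
      (∀ i, ∀ a ∈ cube b.center.ofLp (2 * b.radius), |partialDiff i f a| ≤ τ * F / b.radius) →
      ∀ a ∈ cube b.center.ofLp (2 * b.radius), 1 / 2 * F ≤ |f a| := by
    rintro f hf b F hF ⟨a, ha, hFa⟩ hD a' ha'
    have hb := b.radius_pos
    have h1 := hf.abs_piecewise_sub_le hD ha ha' (h := 4 * b.radius)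
      (fun i => by
        have h2 := abs_sub_le (a' i) (b.center.ofLp i) (a i)
        have h3 := ha i
        have h4 := ha' i
        rw [abs_sub_comm] at h3
        linarith) Finset.univ
    rw [Finset.piecewise_univ, Finset.card_univ, ← hd] at h1
    have h2 : d * (4 * b.radius * (τ * F / b.radius)) = 1 / 2 * F := by
      rw [hτ]; field_simp; ring
    rw [h2] at h1
    have h3 := abs_sub_abs_le_abs_sub (f a) (f a')
    rw [abs_sub_comm] at h3
    linarith
  have sub2 : ∀ b b' : BobBall (EuclideanSpace ℝ ι), b'.toSet ⊆ b.toSet → ∀ y ∈ b'.toSet,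
      y.ofLp ∈ cube b.center.ofLp (2 * b.radius) := fun b b' hs y hy =>
    cube_mono (by linarith [b.radius_pos]) (mem_cube_of_mem_toSet (hs hy))
  -- Induction on the number of variables on which f may depend. Either all slopes are small and f
  -- is flat, or some slope is large somewhere. In the latter case Alice first keeps that slope, a
  -- function of fewer variables, away from zero, and then deletes a neighbourhood of the zero set
  -- of the linearization of f.
  induction n with
  | zero =>
    intro K hK
    refine ⟨0, 1 / 2, by norm_num, fun r f s hr hs hf hD m b F hw hF _ hex => ?_⟩
    rw [Nat.le_zero, Finset.card_eq_zero] at hs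
    subst hs
    have hb := b.radius_pos
    refine forces_of_subset hβ _ _ _ fun b' hs y hy => ?_
    refine flat f hf b F hF hex (fun i a _ => ?_) _ (sub2 b b' hs y hy)
    rw [hD i (by simp), abs_zero]
    positivity
  | succ n ih =>
    intro K hK
    -- The slopes are at most K F / (2 ρ), which is K / (2 τ) times the lower bound τ F / ρ for the
    -- large one.
    obtain ⟨k, c, hc, ih⟩ := ih (K / (2 * τ)) (by positivity)
    -- Waiting l + 1 windows makes the quadratic Taylor error, of order (ρ₂ / ρ)² F, at most half of
    -- the gain β c τ (ρ₂ / ρ) F from the deletion.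
    obtain ⟨l, hl⟩ := exists_pow_lt_of_lt_one
      (show 0 < 2 * β * c * τ / (d ^ 2 * K) by positivity) hβ1
    refine ⟨k + ((l + 1) + 1), min (1 / 2) (β ^ (k + l + 2) * (β * c * τ / 2)),
      lt_min (by norm_num) (by positivity), fun r f s hr hs hf hD m b F hw hF hle hex => ?_⟩
    have hb := b.radius_pos
    by_cases hflat : ∀ i, ∀ a ∈ cube b.center.ofLp (2 * b.radius),
        |partialDiff i f a| ≤ τ * F / b.radius
    · refine forces_of_subset hβ _ _ _ fun b' hs y hy => ?_
      refine le_trans ?_ (flat f hf b F hF hex hflat _ (sub2 b b' hs y hy))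
      exact mul_le_mul_of_nonneg_right (min_le_left _ _) hF
    push Not at hflat
    obtain ⟨i, a, ha, hia⟩ := hflat
    rcases hF.eq_or_lt with hF0 | hF0
    · refine forces_of_subset hβ _ _ _ fun b' hs y hy => ?_
      rw [← hF0, mul_zero]
      exact abs_nonneg _
    have his : i ∈ s := by
      by_contra h
      rw [hD i h, abs_zero] at hia
      have : 0 < τ * F / b.radius := by positivity
      linarith
    have hD1 : ∀ j, ∀ a ∈ cube b.center.ofLp (2 * b.radius), |partialDiff j f a| ≤
        K * F / (2 * b.radius) := fun j a ha => hf.abs_partialDiff_le (by positivity) hle j ha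
    have hD2 : ∀ j j', ∀ a ∈ cube b.center.ofLp (2 * b.radius),
        |partialDiff j' (partialDiff j f) a| ≤ K * F / (2 * b.radius) / (2 * b.radius) :=
      fun j j' a ha => (hf.partialDiff j).abs_partialDiff_le (by positivity) (hD1 j) j' ha
    have h1 := ih r (partialDiff i f) (s.erase i) hr
      (by rw [Finset.card_erase_of_mem his]; omega) (hf.partialDiff i)
      (fun j hj a => by
        by_cases hji : j = i
        · rw [hji]; exact partialDiff_self i f a
        · rw [partialDiff_comm]
          have hjs : j ∉ s := fun h => hj (Finset.mem_erase.2 ⟨hji, h⟩)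
          show partialDiff j f _ - partialDiff j f _ = 0
          rw [hD j hjs, hD j hjs, sub_self])
      m b (τ * F / b.radius) hw (by positivity)
      (fun a ha => (hD1 i a ha).trans (le_of_eq (by field_simp)))
      ⟨a, ha, hia.le⟩
    refine h1.bind hw fun b₁ hb₁ hw₁ hΦ₁ => ?_
    refine Forces.bind (Φ := fun _ => True) hw₁ (forces_of_subset hβ _ _ _ fun _ _ => trivial)
      fun b₂ hb₂ hw₂ _ => ?_
    have hρ₂ := b₂.radius_pos
    have hratio1 : b₂.radius ≤ β ^ l * b.radius := by
      refine hw₂.2.trans ?_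
      have h2 := hw.1
      calc β ^ (m + k + (l + 1)) * r = β ^ (k + l) * (β ^ (m + 1) * r) := by ring
        _ ≤ β ^ (k + l) * b.radius := by gcongr
        _ ≤ β ^ l * b.radius := by
          refine mul_le_mul_of_nonneg_right ?_ hb.le
          exact pow_le_pow_of_le_one hβ.le hβ1.le (by omega)
    have hratio2 : β ^ (k + l + 2) * b.radius ≤ b₂.radius := by
      refine le_trans ?_ hw₂.1.le
      calc β ^ (k + l + 2) * b.radius ≤ β ^ (k + l + 2) * (β ^ m * r) := by gcongr; exact hw.2
        _ = β ^ (m + k + (l + 1) + 1) * r := by ring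
    set a₀ := b₂.center.ofLp with ha₀
    set v : EuclideanSpace ℝ ι := WithLp.toLp 2 fun j => partialDiff j f a₀ with hv
    have hvi : c * (τ * F / b.radius) ≤ ‖v‖ :=
      (hΦ₁ _ (hb₂ b₂.center_mem)).trans (PiLp.norm_apply_le v i)
    have hv0 : v ≠ 0 := by
      rw [← norm_pos_iff]
      exact lt_of_lt_of_le (by positivity) hvi
    obtain ⟨A, hA, hA'⟩ := exists_hyperplane_move hβ b₂ hv0 (inner ℝ v b₂.center - f a₀)
    refine ⟨A, hA, fun b₃ hb₃ hd₃ _ y hy => ?_⟩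
    have h3 := hA' b₃ hd₃ y hy
    have hyc := mem_cube_of_mem_toSet (hb₃ hy)
    have h4 := hf.abs_piecewise_sub_sub_le (by positivity) (Fintype.card ι) hD2
      (sub2 b b₂ (hb₂.trans hb₁) _ b₂.center_mem)
      (sub2 b b₃ (hb₃.trans (hb₂.trans hb₁)) y hy) hyc Finset.univ le_rfl
    rw [Finset.piecewise_univ, Finset.card_univ, ← hd] at h4
    have h5 : inner ℝ v y - (inner ℝ v b₂.center - f a₀) =
        f a₀ + ∑ j, (y.ofLp j - a₀ j) * partialDiff j f a₀ := by
      rw [← sub_add, ← inner_sub_right, add_comm]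
      simp [PiLp.inner_apply, hv, ha₀]
    rw [h5] at h3
    have h6 : |f a₀ + ∑ j, (y.ofLp j - a₀ j) * partialDiff j f a₀| ≤ |f y.ofLp| +
        |f y.ofLp - f a₀ - ∑ j, (y.ofLp j - a₀ j) * partialDiff j f a₀| := by
      refine le_trans (le_of_eq ?_) (abs_sub _ _)
      congr 1; ring
    have h7 : β * b₂.radius * (c * (τ * F / b.radius)) ≤ β * b₂.radius * ‖v‖ := by gcongr
    have h8 : d * (b₂.radius * (d * (b₂.radius * (K * F / (2 * b.radius) / (2 * b.radius))))) ≤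
        b₂.radius / b.radius * F * (β * c * τ / 2) := by
      have h9 : b₂.radius / b.radius ≤ 2 * β * c * τ / (d ^ 2 * K) := by
        rw [div_le_iff₀ hb]
        exact hratio1.trans (mul_le_mul_of_nonneg_right hl.le hb.le)
      rw [le_div_iff₀ (by positivity)] at h9
      calc _ = b₂.radius / b.radius * F * (b₂.radius / b.radius * (d ^ 2 * K) / 4) := by
            field_simp; ring
        _ ≤ b₂.radius / b.radius * F * (2 * β * c * τ / 4) := by gcongr
        _ = _ := by ring
    have h9 : β ^ (k + l + 2) ≤ b₂.radius / b.radius := by rwa [le_div_iff₀ hb]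
    calc min (1 / 2) (β ^ (k + l + 2) * (β * c * τ / 2)) * F
        ≤ β ^ (k + l + 2) * (β * c * τ / 2) * F := by gcongr; exact min_le_right _ _
      _ ≤ b₂.radius / b.radius * (β * c * τ / 2) * F := by gcongr
      _ = β * b₂.radius * (c * (τ * F / b.radius)) -
          b₂.radius / b.radius * F * (β * c * τ / 2) := by field_simp; ring
      _ ≤ |f y.ofLp| := by linarith

end Avoid

/-! ### Subspaces transversal to a graph, and their determinant -/

section Graph

/-- P is injective on K = ker Q, and Q is injective on a complement K'. So A can be prescribed on
Q(K') to make A Q + P an isomorphism of K' onto a complement of P(K), which has the right dimension;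
then A Q + P is injective on K ⊕ K'. -/
lemma exists_linearMap_forall_ne_zero {V X Y : Type*} [AddCommGroup V] [Module ℝ V]
    [FiniteDimensional ℝ V] [AddCommGroup X] [Module ℝ X] [FiniteDimensional ℝ X] [AddCommGroup Y]
    [Module ℝ Y] (P : V →ₗ[ℝ] X) (Q : V →ₗ[ℝ] Y) (hPQ : ∀ v, P v = 0 → Q v = 0 → v = 0)
    (hfr : Module.finrank ℝ V = Module.finrank ℝ X) :
    ∃ A : Y →ₗ[ℝ] X, ∀ v, A (Q v) + P v = 0 → v = 0 := by
  set K := LinearMap.ker Q with hK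
  obtain ⟨K', hK'⟩ := Submodule.exists_isCompl K
  obtain ⟨C, hC⟩ := Submodule.exists_isCompl (K.map P)
  have hfr : Module.finrank ℝ K' = Module.finrank ℝ C := by
    have h1 := Submodule.finrank_add_eq_of_isCompl hK'
    have h2 := Submodule.finrank_add_eq_of_isCompl hC
    have h3 : Module.finrank ℝ (K.map P) = Module.finrank ℝ K := by
      have hinj : Injective (P.domRestrict K) := by
        rw [← LinearMap.ker_eq_bot, LinearMap.ker_eq_bot']
        rintro ⟨x, hx⟩ h
        exact Subtype.ext (hPQ x h hx)
      rw [← LinearMap.finrank_range_of_inj hinj, LinearMap.range_domRestrict]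
    omega
  let φ : K' ≃ₗ[ℝ] C := LinearEquiv.ofFinrankEq _ _ hfr
  have hinj : LinearMap.ker (Q.domRestrict K') = ⊥ := by
    rw [LinearMap.ker_eq_bot']
    rintro ⟨x, hx⟩ h
    exact Subtype.ext (Submodule.disjoint_def.1 hK'.disjoint x h hx)
  obtain ⟨g, hg⟩ := LinearMap.exists_leftInverse_of_injective _ hinj
  refine ⟨(C.subtype ∘ₗ φ.toLinearMap - P.domRestrict K') ∘ₗ g, fun v h0 => ?_⟩
  obtain ⟨x, hx, z, hz, rfl⟩ := Submodule.mem_sup.1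
    (show v ∈ K ⊔ K' by rw [hK'.sup_eq_top]; trivial)
  have e3 : g (Q z) = ⟨z, hz⟩ := LinearMap.congr_fun hg ⟨z, hz⟩
  rw [map_add Q, map_add P, show Q x = 0 from hx, zero_add, LinearMap.comp_apply, e3] at h0
  have e5 : P x = -(φ ⟨z, hz⟩ : X) := by
    rw [eq_neg_iff_add_eq_zero, ← h0]
    simp only [LinearMap.sub_apply, LinearMap.comp_apply, LinearEquiv.coe_coe,
      Submodule.subtype_apply, LinearMap.domRestrict_apply]
    abel
  have e6 : P x = 0 := Submodule.disjoint_def.1 hC.disjoint _ (Submodule.mem_map_of_mem hx)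
    (e5 ▸ neg_mem (φ ⟨z, hz⟩).2)
  have e7 : φ ⟨z, hz⟩ = 0 := by
    apply Subtype.ext
    rw [e6, eq_comm, neg_eq_zero] at e5
    exact e5
  have e8 : z = 0 := congrArg Subtype.val (φ.map_eq_zero_iff.1 e7)
  rw [e8, hPQ x e6 hx, add_zero]

variable {m n : Type*} [Fintype m] [Fintype n]

/-- For a subspace `V` of `ℝ^m × ℝ^n` of dimension `m`, some linear map `ℝ^n → ℝ^m` has a graph
meeting `V` trivially. -/
lemma exists_matrix_forall_ne_zero [DecidableEq n] (V : Submodule ℝ ((m → ℝ) × (n → ℝ)))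
    (hV : Module.finrank ℝ V = Fintype.card m) :
    ∃ A : Matrix m n ℝ, ∀ v ∈ V, A *ᵥ v.2 + v.1 = 0 → v = 0 := by
  obtain ⟨A, hA⟩ := exists_linearMap_forall_ne_zero
    ((LinearMap.fst ℝ (m → ℝ) (n → ℝ)).comp V.subtype)
    ((LinearMap.snd ℝ (m → ℝ) (n → ℝ)).comp V.subtype)
    (fun v h1 h2 => Subtype.ext (Prod.ext h1 h2))
    (by rw [hV, Module.finrank_fintype_fun_eq_card])
  refine ⟨LinearMap.toMatrix' A, fun v hv h0 => ?_⟩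
  rw [LinearMap.toMatrix'_mulVec] at h0
  exact congrArg Subtype.val (hA ⟨v, hv⟩ h0)

variable [DecidableEq m]

/-- The determinant of the values of `v ↦ A v₂ + v₁` on `m` vectors of `ℝ^m × ℝ^n`. -/
noncomputable def formDet (y : m → (m → ℝ) × (n → ℝ)) (A : Matrix m n ℝ) : ℝ :=
  (Matrix.of fun i k => (A *ᵥ (y k).2 + (y k).1) i).det

/-- The matrix represents v ↦ A v₂ + v₁ from V to ℝ^m in the basis `y`, and a square matrix is
singular exactly when it has a kernel. -/
lemma formDet_eq_zero_iff {V : Submodule ℝ ((m → ℝ) × (n → ℝ))} (y : Module.Basis m ℝ V)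
    (A : Matrix m n ℝ) :
    formDet (fun k => (y k : (m → ℝ) × (n → ℝ))) A = 0 ↔ ∃ v ∈ V, v ≠ 0 ∧ A *ᵥ v.2 + v.1 = 0 := by
  have key : ∀ z : m → ℝ, (Matrix.of fun i k => (A *ᵥ (y k : (m → ℝ) × (n → ℝ)).2 +
      (y k : (m → ℝ) × (n → ℝ)).1) i) *ᵥ z = A *ᵥ (∑ k, z k • y k : V).1.2 +
        (∑ k, z k • y k : V).1.1 := by
    intro z
    have h1 : (∑ k, z k • y k : V).1 = ∑ k, z k • (y k : (m → ℝ) × (n → ℝ)) := by simp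
    rw [h1, Prod.fst_sum, Prod.snd_sum, Matrix.mulVec_sum, ← Finset.sum_add_distrib]
    ext i
    simp only [Matrix.mulVec, dotProduct, Matrix.of_apply, Finset.sum_apply, Pi.add_apply,
      Prod.smul_fst, Prod.smul_snd, Pi.smul_apply, smul_eq_mul]
    refine Finset.sum_congr rfl fun k _ => ?_
    rw [add_mul, Finset.sum_mul, mul_comm (z k)]
    congr 1
    exact Finset.sum_congr rfl fun j _ => by ring
  rw [formDet, ← Matrix.exists_mulVec_eq_zero_iff]
  constructor
  · rintro ⟨z, hz, h⟩
    refine ⟨(∑ k, z k • y k : V).1, (∑ k, z k • y k : V).2, fun h0 => hz ?_, by rw [← key, h]⟩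
    have h1 : (∑ k, z k • y k : V) = 0 := Subtype.ext h0
    ext k
    exact Fintype.linearIndependent_iff.1 y.linearIndependent z h1 k
  · rintro ⟨v, hv, hv0, h⟩
    have h1 : (∑ k, y.repr ⟨v, hv⟩ k • y k : V) = ⟨v, hv⟩ := y.sum_repr _
    refine ⟨fun k => y.repr ⟨v, hv⟩ k, fun h0 => hv0 ?_, by rw [key, h1]; exact h⟩
    have h2 : (⟨v, hv⟩ : V) = 0 := by
      rw [← h1]
      exact Finset.sum_eq_zero fun k _ => by rw [congrFun h0 k]; simp
    exact congrArg Subtype.val h2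

end Graph

/-! ### Lower bounds on a subspace of dimension M -/

section Avoid

variable {ι : Type*}

lemma isCompact_cube (c : ι → ℝ) (r : ℝ) : IsCompact (cube c r) := by
  have : cube c r = Set.pi Set.univ fun i => Set.Icc (c i - r) (c i + r) := by
    ext a
    simp only [cube, Set.mem_ofPred_eq, Set.mem_pi, Set.mem_univ, true_implies, Set.mem_Icc, abs_le]
    exact forall_congr' fun i => by constructor <;> rintro ⟨h1, h2⟩ <;> constructor <;> linarith
  rw [this]
  exact isCompact_univ_pi fun i => isCompact_Icc

variable [DecidableEq ι]

/-- The matrix with entries listed by `a`, along a bijection of the indices. -/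
def matrixOf {M N : ℕ} (e : Fin M × Fin N ≃ ι) (a : ι → ℝ) : Matrix (Fin M) (Fin N) ℝ :=
  Matrix.of fun i j => a (e (i, j))

/-- Each entry of A occurs in one row only, affinely, and the determinant is linear in that row. -/
lemma multiAffine_formDet {M N : ℕ} (e : Fin M × Fin N ≃ ι)
    (y : Fin M → (Fin M → ℝ) × (Fin N → ℝ)) :
    MultiAffine fun a => formDet y (matrixOf e a) := by
  intro a i
  obtain ⟨⟨i₀, j₀⟩, rfl⟩ := e.surjective i
  set T : (ι → ℝ) → Matrix (Fin M) (Fin M) ℝ := fun a =>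
    Matrix.of fun i k => (matrixOf e a *ᵥ (y k).2 + (y k).1) i with hT
  have key : ∀ t, T (update a (e (i₀, j₀)) t) = (T a).updateRow i₀
      (T (update a (e (i₀, j₀)) 0) i₀ + t • fun k => (y k).2 j₀) := by
    intro t
    ext i k
    by_cases hi : i = i₀
    · subst hi
      rw [Matrix.updateRow_self]
      simp only [hT, Matrix.of_apply, Pi.add_apply, Pi.smul_apply, smul_eq_mul, Matrix.mulVec,
        dotProduct, matrixOf]
      have h1 : ∀ j, update a (e (i, j₀)) t (e (i, j)) = update a (e (i, j₀)) 0 (e (i, j)) +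
          if j = j₀ then t else 0 := by
        intro j
        by_cases hj : j = j₀
        · simp [hj]
        · simp [hj, update_of_ne]
      simp only [h1, add_mul, Finset.sum_add_distrib, ite_mul, zero_mul]
      simp
      ring
    · rw [Matrix.updateRow_ne hi]
      simp [hT, Matrix.mulVec, dotProduct, matrixOf, hi]
  have key2 : ∀ t, formDet y (matrixOf e (update a (e (i₀, j₀)) t)) =
      ((T a).updateRow i₀ (T (update a (e (i₀, j₀)) 0) i₀)).det +
        t * ((T a).updateRow i₀ fun k => (y k).2 j₀).det := by
    intro t
    rw [← Matrix.det_updateRow_smul, ← Matrix.det_updateRow_add, ← key]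
    rfl
  intro t
  simp only [key2]
  ring

variable [Fintype ι] [Nonempty ι]

/-- Alice can force `A v₂ + v₁` not to be small for `v` in a given subspace of the right
dimension. -/
theorem forces_subspace {β : ℝ} (hβ : 0 < β) (hβ1 : β < 1) : ∃ (k : ℕ) (c : ℝ), 0 < c ∧
    ∀ (M N : ℕ) (e : Fin M × Fin N ≃ ι) (V : Submodule ℝ ((Fin M → ℝ) × (Fin N → ℝ))),
      Module.finrank ℝ V = M → ∀ (r : ℝ) (m : ℕ) (b : BobBall (EuclideanSpace ℝ ι)), 0 < r →
        InWindow β r m b → Forces β r (fun b' => ∀ a ∈ b'.toSet, ∀ v ∈ V,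
          c * b.radius * ‖v.2‖ ≤ ‖matrixOf e a.ofLp *ᵥ v.2 + v.1‖) k m b := by
  obtain ⟨k, c, hc, H⟩ := forces_avoid (ι := ι) hβ hβ1 (Fintype.card ι) 1 one_pos
  have hd0 : (0 : ℝ) < Fintype.card ι := by exact_mod_cast Fintype.card_pos
  refine ⟨k, min 1 (c / Fintype.card ι), lt_min one_pos (by positivity),
    fun M N e V hV r m b hr hw => ?_⟩
  have hb := b.radius_pos
  have y : Module.Basis (Fin M) ℝ V := Module.finBasisOfFinrankEq ℝ V hV
  set f : (ι → ℝ) → ℝ := fun a => formDet (fun k => (y k : (Fin M → ℝ) × (Fin N → ℝ)))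
    (matrixOf e a) with hf
  have hfm : MultiAffine f := multiAffine_formDet e _
  have hcont : Continuous f := by
    refine Continuous.matrix_det ?_
    refine continuous_matrix fun i k => ?_
    simp only [Matrix.of_apply, Matrix.mulVec, dotProduct, matrixOf, Pi.add_apply]
    fun_prop
  -- Taking F to be the maximum of |f| on the cube gives the ratio K = 1 in `forces_avoid`, whatever
  -- V is.
  obtain ⟨a₁, ha₁, hmax⟩ := (isCompact_cube b.center.ofLp (2 * b.radius)).exists_isMaxOn
    ⟨b.center.ofLp, fun i => by simp [hb.le]⟩ hcont.abs.continuousOn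
  have hmax' : ∀ a ∈ cube b.center.ofLp (2 * b.radius), |f a| ≤ |f a₁| := fun a ha => hmax ha
  have hF : 0 < |f a₁| := by
    rw [abs_pos]
    intro h0
    obtain ⟨A, hA⟩ := exists_matrix_forall_ne_zero V (by rw [hV, Fintype.card_fin])
    have h1 := hfm.eq_zero_of_cube (c := b.center.ofLp) (r := 2 * b.radius) (by positivity)
      (fun a ha => abs_nonpos_iff.1 ((hmax' a ha).trans (by rw [h0, abs_zero])))
      (fun i => A (e.symm i).1 (e.symm i).2)
    have h2 : matrixOf e (fun i => A (e.symm i).1 (e.symm i).2) = A := by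
      ext i j; simp [matrixOf]
    simp only [hf, h2] at h1
    obtain ⟨v, hv, hv0, h3⟩ := (formDet_eq_zero_iff y A).1 h1
    exact hv0 (hA v hv h3)
  refine (H r f Finset.univ hr (by simp) hfm (by simp) m b (|f a₁|) hw hF.le
    (by simpa using hmax') ⟨a₁, ha₁, le_rfl⟩).mono hw fun b₁ hb₁ _ hΦ a ha v hv => ?_
  by_contra! hlt
  set w := matrixOf e a.ofLp *ᵥ v.2 + v.1 with hwdef
  set c' := min 1 (c / (Fintype.card ι : ℝ)) with hc'
  have hc'0 : 0 < c' := lt_min one_pos (by positivity)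
  have hq : 0 < ‖v.2‖ := by
    by_contra! h
    have : ‖v.2‖ = 0 := le_antisymm h (norm_nonneg _)
    rw [this, mul_zero] at hlt
    exact absurd hlt (not_lt.2 (norm_nonneg _))
  obtain ⟨j₀, hj₀⟩ : ∃ j, ‖v.2‖ ≤ ‖v.2 j‖ := by
    by_contra! h
    exact lt_irrefl _ ((pi_norm_lt_iff hq).2 h)
  have hj0 : 0 < |v.2 j₀| := hq.trans_le hj₀
  have hj0' : v.2 j₀ ≠ 0 := abs_pos.1 hj0
  -- Correcting the column of a largest coordinate of v₂ makes A v₂ + v₁ vanish, at a cost below c'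
  -- ρ per entry. As c' ≤ 1 the new point stays in the doubled cube; as c' ≤ c / d the value of f
  -- moves by at most c F / 2, contradicting |f| ≥ c F.
  set a' : ι → ℝ := fun i => a.ofLp i -
    if (e.symm i).2 = j₀ then w (e.symm i).1 / v.2 j₀ else 0 with ha'
  have hclose : ∀ i, |a' i - a.ofLp i| ≤ c' * b.radius := by
    intro i
    simp only [ha', sub_sub_cancel_left, abs_neg]
    split_ifs
    · rw [abs_div, div_le_iff₀ hj0]
      calc |w (e.symm i).1| ≤ ‖w‖ := norm_le_pi_norm w _
        _ ≤ c' * b.radius * ‖v.2‖ := hlt.le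
        _ ≤ c' * b.radius * |v.2 j₀| := by gcongr; exact hj₀
    · rw [abs_zero]; positivity
  have ha1 := mem_cube_of_mem_toSet (hb₁ ha)
  have ha2 : a.ofLp ∈ cube b.center.ofLp (2 * b.radius) := cube_mono (by linarith) ha1
  have ha3 : a' ∈ cube b.center.ofLp (2 * b.radius) := by
    intro i
    have h1 := abs_sub_le (a' i) (a.ofLp i) (b.center.ofLp i)
    have h2 := hclose i
    have h3 := ha1 i
    have h4 : c' * b.radius ≤ 1 * b.radius := by gcongr; exact min_le_left _ _
    linarith
  have hfa' : f a' = 0 := by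
    refine (formDet_eq_zero_iff y _).2 ⟨v, hv, fun h => hq.ne' (by rw [h]; simp), ?_⟩
    have h1 : matrixOf e a' *ᵥ v.2 = matrixOf e a.ofLp *ᵥ v.2 - w := by
      ext i
      simp only [Matrix.mulVec, dotProduct, matrixOf, Matrix.of_apply, ha', Equiv.symm_apply_apply,
        Pi.sub_apply, sub_mul, Finset.sum_sub_distrib, ite_mul, zero_mul]
      simp [hj0']
    rw [h1, hwdef]
    abel
  have h1 := hfm.abs_piecewise_sub_le
    (fun i a ha => hfm.abs_partialDiff_le (by positivity) hmax' i ha) ha2 ha3 hclose Finset.univ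
  rw [Finset.piecewise_univ, hfa', zero_sub, abs_neg, Finset.card_univ] at h1
  have h2 := hΦ a ha
  have h3 : (Fintype.card ι : ℝ) * (c' * b.radius * (|f a₁| / (2 * b.radius))) ≤
      c * |f a₁| / 2 := by
    have h4 : c' * Fintype.card ι ≤ c := by
      rw [← le_div_iff₀ hd0]
      exact min_le_right _ _
    calc _ = (c' * Fintype.card ι) * |f a₁| / 2 := by field_simp
      _ ≤ _ := by gcongr
  have h5 : 0 < c * |f a₁| := by positivity
  linarith

end Avoid

/-! ### Minkowski's theorem and two linear-algebra bounds -/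

open MeasureTheory

/-- **Minkowski's theorem on linear forms**. -/
theorem exists_int_ne_zero_abs_lt {n : Type*} [Fintype n] [DecidableEq n] (L : Matrix n n ℝ)
    (hL : L.det ≠ 0) (c : n → ℝ) (hc : ∀ i, 0 < c i) (h : |L.det| < ∏ i, c i) :
    ∃ w : n → ℤ, w ≠ 0 ∧ ∀ i, |(L *ᵥ fun j => (w j : ℝ)) i| < c i := by
  set b := Pi.basisFun ℝ n
  set s : Set (n → ℝ) := (toLin' L) ⁻¹' Set.pi Set.univ fun i => Set.Ioo (-c i) (c i) with hs
  have hmem : ∀ v, v ∈ s ↔ ∀ i, |(L *ᵥ v) i| < c i := by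
    intro v
    simp [hs, abs_lt, Set.mem_pi]
  have hvol : volume s = ENNReal.ofReal (|L.det|⁻¹ * (2 ^ Fintype.card n * ∏ i, c i)) := by
    rw [hs, Measure.addHaar_preimage_linearMap _ (by rwa [LinearMap.det_toLin']),
      LinearMap.det_toLin', Real.volume_pi_Ioo, ← ENNReal.ofReal_prod_of_nonneg
        (fun i _ => by linarith [hc i]), ← ENNReal.ofReal_mul (abs_nonneg _), abs_inv]
    congr 2
    rw [Finset.prod_congr rfl (g := fun i => 2 * c i) fun i _ => by ring, Finset.prod_mul_distrib,
      Finset.prod_const, Finset.card_univ]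
  have hfund : volume (ZSpan.fundamentalDomain b) = 1 := by
    rw [ZSpan.fundamentalDomain_pi_basisFun, Real.volume_pi_Ico]
    simp
  have hlt : volume (ZSpan.fundamentalDomain b) * 2 ^ Module.finrank ℝ (n → ℝ) < volume s := by
    rw [hfund, one_mul, Module.finrank_fintype_fun_eq_card, hvol]
    have h0 : 0 < |L.det| := abs_pos.2 hL
    have h1 : (2 : ℝ) ^ Fintype.card n < |L.det|⁻¹ * (2 ^ Fintype.card n * ∏ i, c i) := by
      rw [inv_mul_eq_div, lt_div_iff₀ h0]
      gcongr
    have h2 : (2 : ENNReal) ^ Fintype.card n = ENNReal.ofReal (2 ^ Fintype.card n) := by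
      rw [ENNReal.ofReal_pow (by norm_num)]; simp
    rw [h2]
    exact (ENNReal.ofReal_lt_ofReal_iff (lt_trans (by positivity) h1)).2 h1
  have : Countable (Submodule.span ℤ (Set.range b)).toAddSubgroup :=
    inferInstanceAs (Countable (Submodule.span ℤ (Set.range b)))
  obtain ⟨x, hx0, hx⟩ := exists_ne_zero_mem_lattice_of_measure_mul_two_pow_lt_measure
    (ZSpan.isAddFundamentalDomain' b volume)
    (fun v hv => by
      rw [hmem] at hv ⊢
      intro i
      rw [mulVec_neg, Pi.neg_apply, abs_neg]
      exact hv i)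
    ((convex_pi fun i _ => convex_Ioo _ _).linear_preimage _) hlt
  have hx' : (x : n → ℝ) ∈ Submodule.span ℤ (Set.range b) := x.2
  rw [b.mem_span_iff_repr_mem ℤ] at hx'
  choose w hw using hx'
  have hw' : (fun j => (w j : ℝ)) = (x : n → ℝ) := by
    ext j
    simpa [b] using hw j
  refine ⟨w, fun h0 => hx0 ?_, by rw [hw']; exact (hmem _).1 hx⟩
  apply Subtype.ext
  rw [← hw', h0]
  ext j
  simp

/-- Each of the n! terms of the Leibniz formula takes one entry from each row; the transpose puts
the product in that order. -/
lemma abs_det_le_of_rows {n : Type*} [Fintype n] [DecidableEq n] (L : Matrix n n ℝ) (c : n → ℝ)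
    (hL : ∀ i j, |L i j| ≤ c i) : |L.det| ≤ (Fintype.card n).factorial * ∏ i, c i := by
  rw [← det_transpose, det_apply']
  refine (Finset.abs_sum_le_sum_abs _ _).trans ?_
  have : ∀ σ ∈ (Finset.univ : Finset (Equiv.Perm n)),
      |((Equiv.Perm.sign σ : ℤ) : ℝ) * ∏ i, Lᵀ (σ i) i| ≤ ∏ i, c i := by
    intro σ _
    rw [abs_mul, Finset.abs_prod]
    have : |((Equiv.Perm.sign σ : ℤ) : ℝ)| = 1 := by
      rcases Int.units_eq_one_or (Equiv.Perm.sign σ) with h | h <;> simp [h]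
    rw [this, one_mul]
    exact Finset.prod_le_prod (fun i _ => abs_nonneg _) fun i _ => hL _ _
  refine (Finset.sum_le_card_nsmul _ _ _ this).trans (le_of_eq ?_)
  rw [Finset.card_univ, Fintype.card_perm, nsmul_eq_mul]

lemma exists_submodule_ge_finrank_eq {E : Type*} [AddCommGroup E] [Module ℝ E]
    [FiniteDimensional ℝ E] (W : Submodule ℝ E) (k : ℕ)
    (hk : Module.finrank ℝ W + k ≤ Module.finrank ℝ E) :
    ∃ V : Submodule ℝ E, W ≤ V ∧ Module.finrank ℝ V = Module.finrank ℝ W + k := by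
  induction k with
  | zero => exact ⟨W, le_rfl, rfl⟩
  | succ k ih =>
    obtain ⟨V, hWV, hV⟩ := ih (by omega)
    obtain ⟨v, hv⟩ := V.exists_of_finrank_lt (by omega)
    have hvV : v ∉ V := by
      have := hv 1 one_ne_zero
      rwa [one_smul] at this
    refine ⟨V ⊔ Submodule.span ℝ {v}, hWV.trans le_sup_left, ?_⟩
    have h1 : Module.finrank ℝ V < Module.finrank ℝ (V ⊔ Submodule.span ℝ {v} : Submodule ℝ E) := by
      refine Submodule.finrank_lt_finrank_of_lt (lt_of_le_of_ne le_sup_left fun h => hvV ?_)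
      rw [h]
      exact Submodule.mem_sup_right (Submodule.mem_span_singleton_self v)
    have h2 := Submodule.finrank_add_le_finrank_add_finrank V (Submodule.span ℝ {v})
    have h3 := finrank_span_le_card (R := ℝ) ({v} : Set E)
    simp at h3
    omega

/-! ### Transference between a matrix and its transpose -/

section Transference

variable {M N : ℕ}

/-- The real vector of an integer vector. -/
def intVec {N : ℕ} (q : Fin N → ℤ) : Fin N → ℝ := fun j => q j

/-- No nonzero integer pair `(p, q)` satisfies `‖q‖ ≤ δ T ^ M` and `‖A q + p‖ ≤ δ T ^ (-N)`. -/
def LatticeGood (A : Matrix (Fin M) (Fin N) ℝ) (T δ : ℝ) : Prop :=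
  ∀ (p : Fin M → ℤ) (q : Fin N → ℤ), ‖intVec q‖ ≤ δ * T ^ M →
    ‖A *ᵥ intVec q + intVec p‖ ≤ δ / T ^ N → p = 0 ∧ q = 0

/-- The linear map `(p, q) ↦ (T ^ N (A q + p), - T ^ (-M) q)`. -/
noncomputable def flowMap (A : Matrix (Fin M) (Fin N) ℝ) (T : ℝ) :
    ((Fin M → ℝ) × (Fin N → ℝ)) →ₗ[ℝ] EuclideanSpace ℝ (Fin M ⊕ Fin N) where
  toFun v := WithLp.toLp 2 (Sum.elim (T ^ N • (A *ᵥ v.2 + v.1)) (-(T ^ M)⁻¹ • v.2))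
  map_add' v w := by
    ext i
    rcases i with i | i
    · simp [Matrix.mulVec_add]; ring
    · simp [Matrix.mulVec_add]
  map_smul' t v := by
    ext i
    rcases i with i | i
    · simp [Matrix.mulVec_smul]; ring
    · simp [Matrix.mulVec_smul]; ring

lemma flowMap_injective (A : Matrix (Fin M) (Fin N) ℝ) {T : ℝ} (hT : 0 < T) :
    Injective (flowMap A T) := by
  rw [injective_iff_map_eq_zero]
  intro v hv
  have h2 : v.2 = 0 := by
    ext j
    have := congrArg (fun y : EuclideanSpace ℝ (Fin M ⊕ Fin N) => y (Sum.inr j)) hv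
    simpa [flowMap, hT.ne'] using this
  refine Prod.ext ?_ h2
  ext i
  have := congrArg (fun y : EuclideanSpace ℝ (Fin M ⊕ Fin N) => y (Sum.inl i)) hv
  simpa [flowMap, hT.ne', h2] using this

/-- The matrix of the dual map `(u, v) ↦ (T ^ (-N) u, T ^ M (Aᵀ u + v))`. -/
noncomputable def dualFlow (A : Matrix (Fin M) (Fin N) ℝ) (T : ℝ) :
    Matrix (Fin M ⊕ Fin N) (Fin M ⊕ Fin N) ℝ :=
  fromBlocks ((T ^ N)⁻¹ • 1) 0 (T ^ M • Aᵀ) (T ^ M • 1)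

lemma det_dualFlow (A : Matrix (Fin M) (Fin N) ℝ) {T : ℝ} (hT : 0 < T) :
    (dualFlow A T).det = 1 := by
  rw [dualFlow, det_fromBlocks_zero₁₂, det_smul, det_smul, det_one, det_one, Fintype.card_fin,
    Fintype.card_fin, inv_pow, ← pow_mul, ← pow_mul, mul_comm N M, mul_one, mul_one,
    inv_mul_cancel₀ (by positivity)]

lemma dualFlow_mulVec (A : Matrix (Fin M) (Fin N) ℝ) (T : ℝ) (u : Fin M → ℝ) (v : Fin N → ℝ) :
    dualFlow A T *ᵥ Sum.elim u v =
      Sum.elim ((T ^ N)⁻¹ • u) (T ^ M • (Aᵀ *ᵥ u + v)) := by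
  rw [dualFlow, fromBlocks_mulVec]
  simp [smul_mulVec, zero_mulVec]

/-- The powers of T and the terms in A cancel, so the pairing takes integer values on integer
vectors. -/
lemma flowMap_dotProduct_dualFlow (A : Matrix (Fin M) (Fin N) ℝ) {T : ℝ} (hT : 0 < T)
    (x : (Fin M → ℝ) × (Fin N → ℝ)) (u : Fin M → ℝ) (v : Fin N → ℝ) :
    (flowMap A T x).ofLp ⬝ᵥ (dualFlow A T *ᵥ Sum.elim u v) = x.1 ⬝ᵥ u - x.2 ⬝ᵥ v := by
  have h : A *ᵥ x.2 ⬝ᵥ u = x.2 ⬝ᵥ Aᵀ *ᵥ u := by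
    rw [Matrix.mulVec_transpose, dotProduct_comm, dotProduct_mulVec, dotProduct_comm]
  have hT1 : T ^ N ≠ 0 := by positivity
  have hT2 : T ^ M ≠ 0 := by positivity
  rw [dualFlow_mulVec]
  show Sum.elim (T ^ N • (A *ᵥ x.2 + x.1)) (-(T ^ M)⁻¹ • x.2) ⬝ᵥ _ = _
  rw [sumElim_dotProduct_sumElim]
  simp only [smul_dotProduct, dotProduct_smul, add_dotProduct, dotProduct_add, h, smul_eq_mul]
  field_simp
  ring

/-- **Transference**: `M + 1` independent integer vectors that are short for the flow of `A` yield a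
nonzero integer vector that is short for the dual flow. -/
theorem exists_dual_vector (A : Matrix (Fin M) (Fin N) ℝ) {T η s : ℝ} (hT : 0 < T) (hs : 0 < s)
    (hηs : (M + N).factorial * η ^ (M + 1) < s ^ (N - 1))
    (p : Fin (M + 1) → Fin M → ℤ) (q : Fin (M + 1) → Fin N → ℤ)
    (hli : LinearIndependent ℝ fun i => (intVec (p i), intVec (q i)))
    (hq : ∀ i, ‖intVec (q i)‖ ≤ η * T ^ M)
    (hp : ∀ i, ‖A *ᵥ intVec (q i) + intVec (p i)‖ ≤ η / T ^ N) :
    ∃ (u : Fin M → ℤ) (v : Fin N → ℤ), (u ≠ 0 ∨ v ≠ 0) ∧ ‖intVec u‖ ≤ N * s * T ^ N ∧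
      ‖Aᵀ *ᵥ intVec u + intVec v‖ ≤ N * s / T ^ M := by
  have hTN : 0 < T ^ N := by positivity
  have hTM : 0 < T ^ M := by positivity
  set y : Fin (M + 1) → EuclideanSpace ℝ (Fin M ⊕ Fin N) :=
    fun i => flowMap A T (intVec (p i), intVec (q i)) with hy
  have hyli : LinearIndependent ℝ y :=
    hli.map' (flowMap A T) (LinearMap.ker_eq_bot.2 (flowMap_injective A hT))
  set H := Submodule.span ℝ (Set.range y) with hH
  have hHr : Module.finrank ℝ H = M + 1 := by
    rw [hH, finrank_span_eq_card hyli, Fintype.card_fin]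
  have hHo : Module.finrank ℝ Hᗮ = N - 1 := by
    have := Submodule.finrank_add_finrank_orthogonal H
    rw [hHr, finrank_euclideanSpace, Fintype.card_sum, Fintype.card_fin, Fintype.card_fin] at this
    omega
  have hMN : M + 1 ≤ M + N := by
    have := Submodule.finrank_le H
    rwa [hHr, finrank_euclideanSpace, Fintype.card_sum, Fintype.card_fin, Fintype.card_fin] at this
  set o : OrthonormalBasis (Fin (N - 1)) ℝ Hᗮ :=
    (stdOrthonormalBasis ℝ Hᗮ).reindex (finCongr hHo) with ho
  -- The short vectors, completed by an orthonormal basis of the orthogonal complement of their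
  -- span, give M + N independent rows. Their determinant is at most (M + N)! η^(M+1).
  set fam : Fin (M + 1) ⊕ Fin (N - 1) → EuclideanSpace ℝ (Fin M ⊕ Fin N) :=
    Sum.elim y fun j => (o j : EuclideanSpace ℝ (Fin M ⊕ Fin N)) with hfam
  have hfli : LinearIndependent ℝ fam := by
    refine LinearIndependent.sum_type hyli ?_ ?_
    · exact o.toBasis.linearIndependent.map' Hᗮ.subtype (Submodule.ker_subtype _) |> fun h => by
        simpa [Function.comp_def] using h
    · refine (Submodule.orthogonal_disjoint H).mono_right ?_
      rw [Submodule.span_le]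
      rintro _ ⟨j, rfl⟩
      exact (o j).2
  have hcard : Fintype.card (Fin (M + 1) ⊕ Fin (N - 1)) = Fintype.card (Fin M ⊕ Fin N) := by
    simp only [Fintype.card_sum, Fintype.card_fin]; omega
  let e := Fintype.equivOfCardEq hcard
  set Z : Matrix (Fin M ⊕ Fin N) (Fin M ⊕ Fin N) ℝ := Matrix.of fun i => (fam (e.symm i)).ofLp
    with hZ
  have hZdet : Z.det ≠ 0 := by
    rw [← isUnit_iff_ne_zero, ← isUnit_iff_isUnit_det, ← linearIndependent_rows_iff_isUnit]
    have h1 := (hfli.comp e.symm e.symm.injective).map'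
      (WithLp.linearEquiv 2 ℝ (Fin M ⊕ Fin N → ℝ)).toLinearMap (LinearEquiv.ker _)
    exact h1
  set bd : Fin (M + 1) ⊕ Fin (N - 1) → ℝ := Sum.elim (fun _ => η) fun _ => 1 with hbd
  have hfb : ∀ i j, |(fam i).ofLp j| ≤ bd i := by
    rintro (i | i) j
    · simp only [hfam, hbd, Sum.elim_inl, hy]
      rcases j with j | j
      · show |T ^ N * (A *ᵥ intVec (q i) + intVec (p i)) j| ≤ η
        rw [abs_mul, abs_of_pos hTN, mul_comm, ← le_div_iff₀ hTN]
        exact (norm_le_pi_norm _ j).trans (hp i)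
      · show |-(T ^ M)⁻¹ * intVec (q i) j| ≤ η
        rw [abs_mul, abs_neg, abs_inv, abs_of_pos hTM, inv_mul_le_iff₀ hTM, mul_comm]
        exact (norm_le_pi_norm _ j).trans (hq i)
    · simp only [hfam, hbd, Sum.elim_inr]
      refine (PiLp.norm_apply_le (o i : EuclideanSpace ℝ (Fin M ⊕ Fin N)) j).trans ?_
      exact (o.norm_eq_one i).le
  -- In Minkowski's theorem the rows of short vectors get the bound 1 and the orthonormal ones the
  -- bound s.
  have hdet : |(Z * dualFlow A T).det| < ∏ i, (Sum.elim (fun _ => 1) (fun _ => s) : _ → ℝ)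
      (e.symm i) := by
    rw [det_mul, det_dualFlow A hT, mul_one]
    have h1 := abs_det_le_of_rows Z (fun i => bd (e.symm i)) fun i j => hfb _ _
    rw [Equiv.prod_comp e.symm bd, Fintype.prod_sum_type] at h1
    rw [Equiv.prod_comp e.symm, Fintype.prod_sum_type]
    simp only [hbd, Sum.elim_inl, Sum.elim_inr, Finset.prod_const, Finset.card_univ,
      Fintype.card_fin, Fintype.card_sum, one_pow, mul_one, one_mul] at h1 ⊢
    exact h1.trans_lt hηs
  obtain ⟨w, hw0, hw⟩ := exists_int_ne_zero_abs_lt (Z * dualFlow A T)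
    (by rw [det_mul, det_dualFlow A hT, mul_one]; exact hZdet) _
    (by intro i; rcases e.symm i with j | j <;> simp [hs]) hdet
  set u : Fin M → ℤ := fun i => w (Sum.inl i) with hu
  set v : Fin N → ℤ := fun i => w (Sum.inr i) with hv
  have hwuv : (fun j => (w j : ℝ)) = Sum.elim (intVec u) (intVec v) := by
    ext (j | j) <;> rfl
  set g : EuclideanSpace ℝ (Fin M ⊕ Fin N) :=
    WithLp.toLp 2 (dualFlow A T *ᵥ Sum.elim (intVec u) (intVec v)) with hg
  have hin : ∀ i, |inner ℝ (fam i) g| < (Sum.elim (fun _ => 1) (fun _ => s) : _ → ℝ) i := by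
    intro i
    have h1 := hw (e i)
    rw [hwuv, ← mulVec_mulVec, e.symm_apply_apply] at h1
    have h2 : inner ℝ (fam i) g = (Z *ᵥ dualFlow A T *ᵥ Sum.elim (intVec u) (intVec v)) (e i) := by
      rw [EuclideanSpace.inner_eq_star_dotProduct, dotProduct_comm]
      simp [mulVec, hZ, hg]
    rwa [h2]
  -- These pairings are integers of absolute value less than 1. Hence g lies in the complement of H,
  -- where its coordinates are all below s.
  have hyg : ∀ i, inner ℝ (y i) g = 0 := by
    intro i
    have h1 := hin (Sum.inl i)
    have h2 : inner ℝ (y i) g = ((p i ⬝ᵥ u - q i ⬝ᵥ v : ℤ) : ℝ) := by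
      rw [EuclideanSpace.inner_eq_star_dotProduct, dotProduct_comm]
      have h3 := flowMap_dotProduct_dualFlow A hT (intVec (p i), intVec (q i)) (intVec u) (intVec v)
      simp only [star_trivial, hy, hg]
      rw [h3]
      simp [dotProduct, intVec]
    simp only [hfam, Sum.elim_inl] at h1
    rw [h2] at h1 ⊢
    have h3 : |p i ⬝ᵥ u - q i ⬝ᵥ v| < 1 := by exact_mod_cast h1
    rw [Int.abs_lt_one_iff.1 h3, Int.cast_zero]
  have hgH : g ∈ Hᗮ := by
    rw [Submodule.mem_orthogonal]
    intro z hz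
    refine Submodule.span_induction (p := fun z _ => inner ℝ z g = 0) ?_ ?_ ?_ ?_ hz
    · rintro _ ⟨i, rfl⟩; exact hyg i
    · simp
    · intro a b _ _ ha hb; rw [inner_add_left, ha, hb, add_zero]
    · intro t a _ ha; rw [inner_smul_left, ha, mul_zero]
  have hgn : ‖g‖ ≤ N * s := by
    have h1 : (⟨g, hgH⟩ : Hᗮ) = ∑ j, inner ℝ (o j) (⟨g, hgH⟩ : Hᗮ) • o j := (o.sum_repr' _).symm
    have h2 : ‖(⟨g, hgH⟩ : Hᗮ)‖ ≤ ∑ j : Fin (N - 1), s := by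
      conv_lhs => rw [h1]
      refine (norm_sum_le _ _).trans (Finset.sum_le_sum fun j _ => ?_)
      rw [norm_smul, o.norm_eq_one, mul_one]
      exact (hin (Sum.inr j)).le
    rw [Finset.sum_const, Finset.card_univ, Fintype.card_fin, nsmul_eq_mul] at h2
    refine (show ‖g‖ ≤ ((N - 1 : ℕ) : ℝ) * s from h2).trans ?_
    gcongr
    omega
  have hNs : 0 ≤ N * s := by positivity
  refine ⟨u, v, ?_, ?_, ?_⟩
  · by_contra! h
    apply hw0
    ext (j | j)
    · exact congrFun h.1 j
    · exact congrFun h.2 j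
  · refine (pi_norm_le_iff_of_nonneg (by positivity)).2 fun j => ?_
    have h1 := (PiLp.norm_apply_le g (Sum.inl j)).trans hgn
    rw [hg, dualFlow_mulVec] at h1
    simp only [Sum.elim_inl, Pi.smul_apply, smul_eq_mul, norm_mul, norm_inv, Real.norm_eq_abs,
      abs_of_pos hTN] at h1
    rwa [inv_mul_le_iff₀ hTN, mul_comm] at h1
  · refine (pi_norm_le_iff_of_nonneg (by positivity)).2 fun j => ?_
    have h1 := (PiLp.norm_apply_le g (Sum.inr j)).trans hgn
    rw [hg, dualFlow_mulVec] at h1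
    simp only [Sum.elim_inr, Pi.smul_apply, smul_eq_mul, norm_mul, Real.norm_eq_abs,
      abs_of_pos hTM] at h1
    rw [le_div_iff₀ hTM, mul_comm]
    exact h1

/-- If the dual flow has no short vector, then the short vectors of the flow lie in a subspace of
dimension `M`. -/
theorem exists_subspace_of_dual_good (hN : 1 ≤ N) (A : Matrix (Fin M) (Fin N) ℝ) {T η s : ℝ}
    (hT : 0 < T) (hs : 0 < s)
    (hηs : (M + N).factorial * η ^ (M + 1) < s ^ (N - 1)) (hA : LatticeGood Aᵀ T (N * s)) :
    ∃ V : Submodule ℝ ((Fin M → ℝ) × (Fin N → ℝ)), Module.finrank ℝ V = M ∧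
      ∀ (p : Fin M → ℤ) (q : Fin N → ℤ), ‖intVec q‖ ≤ η * T ^ M →
        ‖A *ᵥ intVec q + intVec p‖ ≤ η / T ^ N → (intVec p, intVec q) ∈ V := by
  set X : Set ((Fin M → ℝ) × (Fin N → ℝ)) := {x | ∃ (p : Fin M → ℤ) (q : Fin N → ℤ),
    ‖intVec q‖ ≤ η * T ^ M ∧ ‖A *ᵥ intVec q + intVec p‖ ≤ η / T ^ N ∧
      x = (intVec p, intVec q)} with hX
  have hr : Module.finrank ℝ (Submodule.span ℝ X) ≤ M := by
    by_contra! hlt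
    obtain ⟨f, hfX, -, hfli⟩ := Submodule.exists_fun_fin_finrank_span_eq ℝ X
    choose p q hq hp hpq using fun i : Fin (M + 1) => hfX (Fin.castLE hlt i)
    have hli : LinearIndependent ℝ fun i => (intVec (p i), intVec (q i)) := by
      have h1 := hfli.comp (Fin.castLE hlt) (Fin.castLE_injective hlt)
      rw [show (fun i => (intVec (p i), intVec (q i))) = f ∘ Fin.castLE hlt from
        funext fun i => (hpq i).symm]
      exact h1
    -- For the transpose u plays the part of q and v that of p.
    obtain ⟨u, v, huv, hu, hv⟩ := exists_dual_vector A hT hs hηs p q hli hq hp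
    have := hA v u hu hv
    tauto
  obtain ⟨V, hV, hVr⟩ := exists_submodule_ge_finrank_eq (Submodule.span ℝ X)
    (M - Module.finrank ℝ (Submodule.span ℝ X)) (by
      rw [Module.finrank_prod, Module.finrank_fintype_fun_eq_card,
        Module.finrank_fintype_fun_eq_card, Fintype.card_fin, Fintype.card_fin]
      omega)
  exact ⟨V, by omega, fun p q hq hp => hV (Submodule.subset_span ⟨p, q, hq, hp, rfl⟩)⟩

end Transference

/-! ### Alice's plan between two consecutive times -/

section Steps

variable {ι : Type*} {M N : ℕ}

lemma norm_matrixOf_mulVec_le (e : Fin M × Fin N ≃ ι) {a a' : ι → ℝ} {h : ℝ} (hh : 0 ≤ h)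
    (ha : ∀ i, |a i - a' i| ≤ h) (q : Fin N → ℝ) (z : Fin M → ℝ) :
    ‖matrixOf e a *ᵥ q + z‖ ≤ ‖matrixOf e a' *ᵥ q + z‖ + N * (h * ‖q‖) := by
  have h1 : matrixOf e a *ᵥ q + z = (matrixOf e a' *ᵥ q + z) +
      (matrixOf e a - matrixOf e a') *ᵥ q := by
    rw [Matrix.sub_mulVec]; abel
  rw [h1]
  refine (norm_add_le _ _).trans (add_le_add le_rfl ?_)
  refine (pi_norm_le_iff_of_nonneg (by positivity)).2 fun i => ?_
  show ‖∑ j, (matrixOf e a - matrixOf e a') i j * q j‖ ≤ _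
  refine (norm_sum_le _ _).trans ?_
  refine (Finset.sum_le_card_nsmul _ _ (h * ‖q‖) fun j _ => ?_).trans (by simp)
  rw [norm_mul]
  exact mul_le_mul (ha (e (i, j))) (norm_le_pi_norm q j) (norm_nonneg _) hh

lemma intVec_sub (q q' : Fin N → ℤ) : intVec (q - q') = intVec q - intVec q' := by
  ext j; simp [intVec]

variable [Fintype ι]

/-- Alice can pass from the time `T` to the time `R * T`, keeping the flow away from short
vectors. -/
lemma forces_latticeGood {β r c : ℝ} {k : ℕ} (e : Fin M × Fin N ≃ ι) (hN : 1 ≤ N) (hr : 0 < r)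
    (hc : 0 < c)
    (H : ∀ V : Submodule ℝ ((Fin M → ℝ) × (Fin N → ℝ)),
      Module.finrank ℝ V = M → ∀ (m : ℕ) (b : BobBall (EuclideanSpace ℝ ι)),
        InWindow β r m b → Forces β r (fun b' => ∀ a ∈ b'.toSet, ∀ v ∈ V,
          c * b.radius * ‖v.2‖ ≤ ‖matrixOf e a.ofLp *ᵥ v.2 + v.1‖) k m b)
    {lam R δ δ' T : ℝ} (hlam : 0 < lam) (hR : 1 ≤ R) (hδ : 0 < δ) (hδ' : 0 < δ') (hT : 0 < T)
    (hcR : 1 ≤ c * lam * R ^ N)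
    (hδδ : (M + N).factorial * (δ * R ^ M * (1 + N * r)) ^ (M + 1) < (δ' / N) ^ (N - 1))
    {m : ℕ} {b : BobBall (EuclideanSpace ℝ ι)} (hw : InWindow β r m b)
    (hb1 : lam / T ^ (M + N) ≤ b.radius) (hb2 : b.radius ≤ r / T ^ (M + N))
    (hg : ∀ a ∈ b.toSet, LatticeGood (matrixOf e a.ofLp) T δ)
    (hg' : ∀ a ∈ b.toSet, LatticeGood (matrixOf e a.ofLp)ᵀ T δ') :
    Forces β r (fun b' => ∀ a ∈ b'.toSet, LatticeGood (matrixOf e a.ofLp) (R * T) δ) k m b := by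
  have hN0 : (0 : ℝ) < N := by exact_mod_cast hN
  have hρ := b.radius_pos
  have hTM : 0 < T ^ M := by positivity
  have hTN : 0 < T ^ N := by positivity
  have hRM : 1 ≤ R ^ M := one_le_pow₀ hR
  have hRN : 1 ≤ R ^ N := one_le_pow₀ hR
  have hR0 : 0 < R := by linarith
  -- V is computed at the center alone. In η = δ R^M (1 + N r), the factor R^M admits the longer q
  -- of time R T and 1 + N r pays for moving from any matrix of the ball to the center.
  obtain ⟨V, hV, hmem⟩ := exists_subspace_of_dual_good hN (matrixOf e b.center.ofLp) hT
    (show 0 < δ' / N by positivity) hδδ (by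
      rw [mul_div_cancel₀ _ hN0.ne']
      exact hg' _ b.center_mem)
  refine (H V hV m b hw).mono hw fun b' hb' _ hΦ a ha p q hq hp => ?_
  have hqb : ‖intVec q‖ ≤ δ * R ^ M * T ^ M := by rw [mul_assoc, ← mul_pow]; exact hq
  have hpb : ‖matrixOf e a.ofLp *ᵥ intVec q + intVec p‖ ≤ δ / T ^ N := by
    refine hp.trans ?_
    rw [mul_pow]
    exact div_le_div_of_nonneg_left hδ.le hTN (le_mul_of_one_le_left hTN.le hRN)
  have hV' : (intVec p, intVec q) ∈ V := by
    refine hmem p q ?_ ?_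
    · refine hqb.trans ?_
      have : 1 ≤ 1 + N * r := by linarith [mul_pos hN0 hr]
      exact mul_le_mul_of_nonneg_right (le_mul_of_one_le_right (by positivity) this) hTM.le
    · have h1 := norm_matrixOf_mulVec_le e (a := b.center.ofLp) (a' := a.ofLp) hρ.le
        (fun i => by
          rw [abs_sub_comm]
          exact mem_cube_of_mem_toSet (hb' ha) i) (intVec q) (intVec p)
      refine h1.trans ?_
      have h2 : N * (b.radius * ‖intVec q‖) ≤ N * (r / T ^ (M + N) * (δ * R ^ M * T ^ M)) := by
        gcongr
      have h3 : δ / T ^ N ≤ δ * R ^ M / T ^ N := by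
        gcongr
        exact le_mul_of_one_le_right hδ.le hRM
      have h4 : δ * R ^ M * (1 + N * r) / T ^ N = δ * R ^ M / T ^ N +
          N * (r / T ^ (M + N) * (δ * R ^ M * T ^ M)) := by
        rw [pow_add]; field_simp
      rw [h4]
      linarith
  -- The bound on V gives c ρ ‖q‖ ≤ δ / (R T)^N; with ρ ≥ lam / T^(M+N) and c lam R^N ≥ 1 this
  -- yields ‖q‖ ≤ δ T^M, so goodness at time T applies.
  refine hg a (hb' ha) p q ?_ hpb
  have h1 := (hΦ a ha _ hV').trans hp
  have h2 : c * (lam / T ^ (M + N)) * ‖intVec q‖ ≤ δ / (R * T) ^ N := by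
    refine le_trans ?_ h1
    gcongr
  have h3 : c * (lam / T ^ (M + N)) * ‖intVec q‖ * (R ^ N * T ^ (M + N)) ≤ δ * T ^ M := by
    calc _ ≤ δ / (R * T) ^ N * (R ^ N * T ^ (M + N)) := by gcongr
      _ = δ * T ^ M := by rw [pow_add, mul_pow]; field_simp
  calc ‖intVec q‖ ≤ (c * lam * R ^ N) * ‖intVec q‖ := le_mul_of_one_le_left (norm_nonneg _) hcR
    _ = c * (lam / T ^ (M + N)) * ‖intVec q‖ * (R ^ N * T ^ (M + N)) := by field_simp
    _ ≤ _ := h3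

/-- At each time only one integer vector can make the affine forms small on Bob's ball, and Alice
deletes a hyperplane accordingly. -/
lemma forces_affine [DecidableEq ι] [Nonempty ι] {β r : ℝ} (hβ : 0 < β) (e : Fin M × Fin N ≃ ι)
    (hM : 1 ≤ M) (x : Fin M → ℝ) {δ γ T : ℝ} (hδ : 0 < δ) (hγ : 0 < γ) (hγ2 : 2 * γ ≤ 1)
    (hγr : 4 * (N * r * γ) ≤ 1) (hT : 0 < T) {m : ℕ} {b : BobBall (EuclideanSpace ℝ ι)}
    (hb2 : b.radius ≤ r / T ^ (M + N))
    (hg : ∀ a ∈ b.toSet, LatticeGood (matrixOf e a.ofLp) T δ) :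
    Forces β r (fun b' => ∀ a ∈ b'.toSet, ∀ (p : Fin M → ℤ) (q : Fin N → ℤ), q ≠ 0 →
      ‖intVec q‖ ≤ γ * δ * T ^ M →
        δ / (4 * T ^ N) ≤ ‖matrixOf e a.ofLp *ᵥ intVec q + (intVec p - x)‖ ∨
        β * b.radius * ‖intVec q‖ ≤ ‖matrixOf e a.ofLp *ᵥ intVec q + (intVec p - x)‖) 1 m b := by
  have hρ := b.radius_pos
  have hTM : 0 < T ^ M := by positivity
  have hTN : 0 < T ^ N := by positivity
  let Small : (Fin M → ℤ) → (Fin N → ℤ) → Prop := fun p q => q ≠ 0 ∧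
    ‖intVec q‖ ≤ γ * δ * T ^ M ∧ ∃ a ∈ b.toSet,
      ‖matrixOf e a.ofLp *ᵥ intVec q + (intVec p - x)‖ < δ / (4 * T ^ N)
  have hcenter : ∀ p q, Small p q →
      ‖matrixOf e b.center.ofLp *ᵥ intVec q + (intVec p - x)‖ ≤ δ / (2 * T ^ N) := by
    rintro p q ⟨-, hq, a, ha, hlt⟩
    have h1 := norm_matrixOf_mulVec_le e (a := b.center.ofLp) (a' := a.ofLp) hρ.le
      (fun i => by
        rw [abs_sub_comm]
        exact mem_cube_of_mem_toSet ha i) (intVec q) (intVec p - x)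
    have h2 : N * (b.radius * ‖intVec q‖) ≤ N * (r / T ^ (M + N) * (γ * δ * T ^ M)) :=
      mul_le_mul_of_nonneg_left (mul_le_mul hb2 hq (norm_nonneg _) (hρ.le.trans hb2)) (by positivity)
    have h3 : N * (r / T ^ (M + N) * (γ * δ * T ^ M)) = 4 * (N * r * γ) * (δ / (4 * T ^ N)) := by
      rw [pow_add]; field_simp
    have h4 : 4 * (N * r * γ) * (δ / (4 * T ^ N)) ≤ δ / (4 * T ^ N) :=
      mul_le_of_le_one_left (by positivity) hγr
    have h5 : δ / (2 * T ^ N) = δ / (4 * T ^ N) + δ / (4 * T ^ N) := by field_simp; norm_num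
    linarith
  -- The difference of two such pairs is short at the center, by 2 γ ≤ 1 and the bound δ / (2 T^N)
  -- for each.
  have huniq : ∀ p q p' q', Small p q → Small p' q' → p = p' ∧ q = q' := by
    intro p q p' q' h h'
    have h1 := hg _ b.center_mem (p - p') (q - q') (by
      rw [intVec_sub]
      refine (norm_sub_le _ _).trans ((add_le_add h.2.1 h'.2.1).trans ?_)
      have : 2 * γ * (δ * T ^ M) ≤ 1 * (δ * T ^ M) := by gcongr
      linarith) (by
      rw [intVec_sub, intVec_sub, Matrix.mulVec_sub]
      have h2 := (norm_sub_le _ _).trans (add_le_add (hcenter p q h) (hcenter p' q' h'))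
      have h3 : δ / (2 * T ^ N) + δ / (2 * T ^ N) = δ / T ^ N := by field_simp; norm_num
      rw [h3] at h2
      refine le_trans (le_of_eq ?_) h2
      congr 1
      abel)
    exact ⟨sub_eq_zero.1 h1.1, sub_eq_zero.1 h1.2⟩
  by_cases hex : ∃ p q, Small p q
  · obtain ⟨p₀, q₀, h₀⟩ := hex
    -- One coordinate of A q₀ + p₀ - x suffices. It is an affine function of A whose gradient `v`
    -- carries the entries of q₀ in row i₀.
    let i₀ : Fin M := ⟨0, hM⟩
    set v : EuclideanSpace ℝ ι := WithLp.toLp 2 fun i =>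
      if (e.symm i).1 = i₀ then intVec q₀ (e.symm i).2 else 0 with hv
    have hvq : ‖intVec q₀‖ ≤ ‖v‖ := by
      refine (pi_norm_le_iff_of_nonneg (norm_nonneg _)).2 fun j => ?_
      have := PiLp.norm_apply_le v (e (i₀, j))
      simpa [hv] using this
    have hv0 : v ≠ 0 := by
      intro h
      rw [h, norm_zero, norm_le_zero_iff] at hvq
      refine h₀.1 (funext fun j => ?_)
      have := congrFun hvq j
      simpa [intVec] using this
    obtain ⟨A, hA, hA'⟩ := exists_hyperplane_move hβ b hv0 (x i₀ - p₀ i₀)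
    refine ⟨A, hA, fun b' hb' hd _ a ha p q hq0 hq => ?_⟩
    by_contra! h
    obtain ⟨rfl, rfl⟩ := huniq p q p₀ q₀ ⟨hq0, hq, a, hb' ha, h.1⟩ h₀
    have h1 := hA' b' hd a ha
    have h2 : inner ℝ v a - (x i₀ - p i₀) =
        (matrixOf e a.ofLp *ᵥ intVec q + (intVec p - x)) i₀ := by
      have h3 : inner ℝ v a = (matrixOf e a.ofLp *ᵥ intVec q) i₀ := by
        rw [PiLp.inner_apply, ← e.sum_comp, Fintype.sum_prod_type]
        simp [hv, Matrix.mulVec, dotProduct, matrixOf, mul_comm, Finset.sum_ite_irrel]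
      rw [h3]
      simp [intVec]
      ring
    rw [h2] at h1
    have h3 := norm_le_pi_norm (matrixOf e a.ofLp *ᵥ intVec q + (intVec p - x)) i₀
    rw [Real.norm_eq_abs] at h3
    have h4 : β * b.radius * ‖intVec q‖ ≤ β * b.radius * ‖v‖ := by gcongr
    linarith [h.2]
  · refine forces_of_subset hβ _ _ _ fun b' hb' a ha p q hq0 hq => Or.inl ?_
    by_contra! h
    exact hex ⟨p, q, hq0, hq, a, hb' ha, h⟩

end Steps

/-! ### Scales, choice of constants and conclusion -/

section Final

variable {M N : ℕ}

lemma norm_le_euclidean {n : ℕ} (v : EuclideanSpace ℝ (Fin n)) : ‖v.ofLp‖ ≤ ‖v‖ :=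
  (pi_norm_le_iff_of_nonneg (norm_nonneg _)).2 fun i => PiLp.norm_apply_le v i

/-- The sup norm is at most the Euclidean norm, so the sup-norm bounds from the game transfer. -/
lemma le_infDist_integerLattice {A : Matrix (Fin M) (Fin N) ℝ} {x : EuclideanSpace ℝ (Fin M)}
    {q : Fin N → ℤ} {t : ℝ}
    (h : ∀ p : Fin M → ℤ, t ≤ ‖A *ᵥ intVec q + (intVec p - x.ofLp)‖) :
    t ≤ Metric.infDist (affineForm A x q) (integerLattice M) := by
  refine (Metric.le_infDist (Set.range_nonempty _)).2 ?_
  rintro _ ⟨p, rfl⟩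
  refine (h (-p)).trans ?_
  rw [dist_eq_norm]
  refine le_trans (le_of_eq ?_) (norm_le_euclidean _)
  congr 1
  ext i
  simp [affineForm, intVec, Matrix.mulVec, dotProduct]
  ring

/-- A lower bound for the affine forms at each scale `R ^ n` implies bad approximability. -/
lemma mem_badSlice_of_scales (hM : 1 ≤ M) (hN : 1 ≤ N) {A : Matrix (Fin M) (Fin N) ℝ}
    {x : EuclideanSpace ℝ (Fin M)} {R κ μ : ℝ} (hR : 1 < R) (hκ : 0 < κ) (hκ1 : κ < 1) (hμ : 0 < μ)
    (h : ∀ (n : ℕ) (p : Fin M → ℤ) (q : Fin N → ℤ), q ≠ 0 → κ * (R ^ n) ^ M < ‖intVec q‖ →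
      ‖intVec q‖ ≤ κ * (R ^ (n + 1)) ^ M →
      μ / (R ^ n) ^ N ≤ ‖A *ᵥ intVec q + (intVec p - x.ofLp)‖) :
    A ∈ BadSlice M N x := by
  have hM0 : (M : ℝ) ≠ 0 := by exact_mod_cast (by omega : M ≠ 0)
  rw [BadSlice, Set.mem_ofPred_eq, Bad, Set.mem_ofPred_eq]
  have : Nonempty {q : Fin N → ℤ // q ≠ 0} :=
    ⟨⟨fun _ => 1, fun h => one_ne_zero (congrFun h ⟨0, hN⟩)⟩⟩
  refine lt_of_lt_of_le (b := κ ^ ((N : ℝ) / M) * μ) (by positivity) (le_ciInf ?_)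
  rintro ⟨q, hq⟩
  have hq1 : 1 ≤ ‖intVec q‖ := by
    obtain ⟨j, hj⟩ := Function.ne_iff.1 hq
    refine le_trans ?_ (norm_le_pi_norm _ j)
    have h1 : (1 : ℤ) ≤ |q j| := Int.one_le_abs hj
    rw [Real.norm_eq_abs, intVec]
    exact_mod_cast h1
  have hex : ∃ n : ℕ, ‖intVec q‖ ≤ κ * (R ^ n) ^ M := by
    obtain ⟨n, hn⟩ := pow_unbounded_of_one_lt (‖intVec q‖ / κ) hR
    refine ⟨n, ?_⟩
    rw [div_lt_iff₀' hκ] at hn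
    have h1 : R ^ n ≤ (R ^ n) ^ M := le_self_pow₀ (one_le_pow₀ hR.le) (by omega)
    exact hn.le.trans (mul_le_mul_of_nonneg_left h1 hκ.le)
  classical
  -- The first scale is not 0, because κ < 1 ≤ ‖q‖.
  obtain ⟨n, hn⟩ : ∃ n, Nat.find hex = n + 1 := by
    refine Nat.exists_eq_succ_of_ne_zero fun h0 => ?_
    have := Nat.find_spec hex
    rw [h0] at this
    simp at this
    linarith
  have h1 : ‖intVec q‖ ≤ κ * (R ^ (n + 1)) ^ M := hn ▸ Nat.find_spec hex
  have h2 : κ * (R ^ n) ^ M < ‖intVec q‖ := not_le.1 (Nat.find_min hex (by omega))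
  have h3 := le_infDist_integerLattice (A := A) (x := x) fun p => h n p q hq h2 h1
  have h4 : κ ^ ((N : ℝ) / M) * (R ^ n) ^ N ≤ intNorm q ^ ((N : ℝ) / M) := by
    have h5 : ((R ^ n) ^ M) ^ ((N : ℝ) / M) = (R ^ n) ^ N := by
      rw [← Real.rpow_natCast (R ^ n) M, ← Real.rpow_mul (by positivity), mul_div_cancel₀ _ hM0,
        Real.rpow_natCast]
    rw [← h5, ← Real.mul_rpow hκ.le (by positivity)]
    refine Real.rpow_le_rpow (by positivity) (h2.le.trans ?_) (by positivity)
    exact norm_le_euclidean (WithLp.toLp 2 fun j => (q j : ℝ))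
  calc κ ^ ((N : ℝ) / M) * μ = κ ^ ((N : ℝ) / M) * (R ^ n) ^ N * (μ / (R ^ n) ^ N) := by
        field_simp
    _ ≤ _ := mul_le_mul h4 h3 (by positivity) (by unfold intNorm; positivity)

/-- At time 1 shortness means sup norm below 1, which excludes nonzero integer vectors. Bob's first
ball thus needs no preparation. -/
lemma latticeGood_one {A : Matrix (Fin M) (Fin N) ℝ} {δ : ℝ} (hδ : δ < 1) :
    LatticeGood A 1 δ := by
  have key : ∀ {n : ℕ} (q : Fin n → ℤ), ‖intVec q‖ < 1 → q = 0 := by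
    intro n q hq
    ext j
    have h1 := (norm_le_pi_norm (intVec q) j).trans_lt hq
    rw [Real.norm_eq_abs, intVec] at h1
    exact Int.abs_lt_one_iff.1 (by exact_mod_cast h1)
  intro p q hq hp
  simp only [one_pow, mul_one, div_one] at hq hp
  have hq0 := key q (hq.trans_lt hδ)
  subst hq0
  have h0 : intVec (0 : Fin N → ℤ) = 0 := by ext; simp [intVec]
  rw [h0, Matrix.mulVec_zero, zero_add] at hp
  exact ⟨key p (hp.trans_lt hδ), rfl⟩

/-- The smallness needed to apply transference in both directions. -/
lemma exists_small_parameter (hM : 1 ≤ M) (hN : 1 ≤ N) {C C' : ℝ} (hC : 0 < C) (hC' : 0 < C') :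
    ∃ ε : ℝ, 0 < ε ∧ ε < 1 ∧
      (M + N).factorial * (ε ^ N * C) ^ (M + 1) < (ε ^ M / N) ^ (N - 1) ∧
      (N + M).factorial * (ε ^ M * C') ^ (N + 1) < (ε ^ N / M) ^ (M - 1) := by
  have aux : ∀ (M N : ℕ), 1 ≤ N → ∀ C ε : ℝ, 0 < C → 0 < ε → ε < 1 →
      ε * ((M + N).factorial * C ^ (M + 1) * (N : ℝ) ^ (N - 1)) < 1 →
      (M + N).factorial * (ε ^ N * C) ^ (M + 1) < (ε ^ M / N) ^ (N - 1) := by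
    intro M N hN C ε hC hε hε1 h
    have hN0 : (0 : ℝ) < N := by exact_mod_cast hN
    obtain ⟨n, rfl⟩ : ∃ n, N = n + 1 := ⟨N - 1, by omega⟩
    rw [Nat.add_sub_cancel] at h ⊢
    rw [div_pow, lt_div_iff₀ (by positivity)]
    -- Exponent N (M + 1) on the left exceeds M (N - 1) on the right by M + N; one spare ε absorbs
    -- the constants. The choice of ε^N and ε^M makes this work in both directions.
    have e : ((M + (n + 1)).factorial : ℝ) * (ε ^ (n + 1) * C) ^ (M + 1) * ((n + 1 : ℕ) : ℝ) ^ n =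
        (ε ^ M) ^ n * (ε ^ (M + n) * (ε * ((M + (n + 1)).factorial * C ^ (M + 1) *
          ((n + 1 : ℕ) : ℝ) ^ n))) := by
      rw [mul_pow, ← pow_mul, ← pow_mul,
        show (n + 1) * (M + 1) = M * n + (M + n) + 1 by ring, pow_succ, pow_add]
      ring
    rw [e]
    refine mul_lt_of_lt_one_right (by positivity) ?_
    exact mul_lt_one_of_nonneg_of_lt_one_right (pow_le_one₀ hε.le hε1.le) (by positivity) h
  set D : ℝ := (M + N).factorial * C ^ (M + 1) * (N : ℝ) ^ (N - 1) with hD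
  set D' : ℝ := (N + M).factorial * C' ^ (N + 1) * (M : ℝ) ^ (M - 1) with hD'
  have hD0 : 0 ≤ D := by positivity
  have hD0' : 0 ≤ D' := by positivity
  have hε0 : 0 < 1 / (2 + D + D') := by positivity
  refine ⟨1 / (2 + D + D'), hε0, ?_, aux M N hN C _ hC hε0 ?_ ?_,
    aux N M hM C' _ hC' hε0 ?_ ?_⟩
  all_goals
    first
      | rw [← hD, one_div_mul_eq_div, div_lt_one (by positivity)]
      | rw [← hD', one_div_mul_eq_div, div_lt_one (by positivity)]
      | rw [div_lt_one (by positivity)]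
    linarith

/-- For each `0 < β < 1 / 3`, Alice wins the `β`-absolute game for the badly approximable
matrices. -/
theorem isBetaAbsoluteWinning_badSlice (hM : 1 ≤ M) (hN : 1 ≤ N) (x : EuclideanSpace ℝ (Fin M))
    {β : ℝ} (hβ : 0 < β) (hβ' : β < 1 / 3) :
    IsBetaAbsoluteWinning (Module.finrank ℝ (EuclideanSpace ℝ (Fin M × Fin N)) - 1) β
      {a : EuclideanSpace ℝ (Fin M × Fin N) | toMatrix a ∈ BadSlice M N x} := by
  have hβ1 : β < 1 := by linarith
  have : Nonempty (Fin M × Fin N) := ⟨(⟨0, hM⟩, ⟨0, hN⟩)⟩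
  obtain ⟨k, c, hc, H⟩ := forces_subspace (ι := Fin M × Fin N) hβ hβ1
  refine isBetaAbsoluteWinning_of_forces hβ hβ' fun b₀ => ?_
  set r := b₀.radius
  have hr : 0 < r := b₀.radius_pos
  -- Alice's plans in a block start within its first 2 k windows after the initial one, so the balls
  -- they start from have radius at least lam / T^(M+N).
  set lam := β ^ (2 * k + 1) * r with hlam
  have hlam0 : 0 < lam := by positivity
  -- R is chosen after k and c: β^l makes c lam R ≥ 1, and the summand 2 k + 1 of L leaves room in a
  -- block for all three plans.
  obtain ⟨l, hl⟩ := exists_pow_lt_of_lt_one (show 0 < c * lam by positivity) hβ1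
  set L := l + (2 * k + 1) with hL
  set R : ℝ := (β ^ L)⁻¹ with hRdef
  have hβL : β ^ L < 1 := pow_lt_one₀ hβ.le hβ1 (by omega)
  have hR1 : 1 < R := (one_lt_inv₀ (by positivity)).2 hβL
  have hcR : ∀ n : ℕ, 1 ≤ n → 1 ≤ c * lam * R ^ n := by
    intro n hn
    have h1 : β ^ L ≤ c * lam := (pow_le_pow_of_le_one hβ.le hβ1.le (by omega)).trans hl.le
    have h2 : R ≤ R ^ n := le_self_pow₀ hR1.le (by omega)
    calc (1 : ℝ) = β ^ L * R := by rw [hRdef, mul_inv_cancel₀ (by positivity)]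
      _ ≤ c * lam * R ^ n := by gcongr
  obtain ⟨ε, hε0, hε1, hεa, hεb⟩ := exists_small_parameter hM hN
    (C := R ^ M * (1 + N * r)) (C' := R ^ N * (1 + M * r)) (by positivity) (by positivity)
  rw [← mul_assoc] at hεa hεb
  set δ := ε ^ N with hδ
  set δ' := ε ^ M with hδ'
  have hδ0 : 0 < δ := by positivity
  have hδ0' : 0 < δ' := by positivity
  have hδ1 : δ < 1 := pow_lt_one₀ hε0.le hε1 (by omega)
  have hδ1' : δ' < 1 := pow_lt_one₀ hε0.le hε1 (by omega)
  set γ : ℝ := 1 / (2 + 4 * (N * r)) with hγ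
  have hγ0 : 0 < γ := by positivity
  have hγ2 : 2 * γ ≤ 1 := by
    rw [hγ, mul_one_div, div_le_one (by positivity)]
    linarith [show 0 ≤ 4 * (N * r) by positivity]
  have hγr : 4 * (N * r * γ) ≤ 1 := by
    rw [hγ, ← mul_assoc, mul_one_div, div_le_one (by positivity)]
    linarith
  -- K windows shrink the radius scale by R^(M+N), which is exactly multiplication of T by R.
  set K := L * (M + N) with hK
  have hKL : L ≤ K := Nat.le_mul_of_pos_right _ (by omega)
  have hTK : ∀ n : ℕ, β ^ (n * K) = 1 / (R ^ n) ^ (M + N) := by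
    intro n
    rw [hRdef, hK, inv_pow, inv_pow, one_div, inv_inv, ← pow_mul, ← pow_mul]
    congr 1
    ring
  let e := Equiv.refl (Fin M × Fin N)
  -- With the indices swapped, `matrixOf e'` is the transpose of `matrixOf e`.
  let e' := Equiv.prodComm (Fin N) (Fin M)
  let Good : ℕ → BobBall (EuclideanSpace ℝ (Fin M × Fin N)) → Prop := fun n b =>
    ∀ a ∈ b.toSet, LatticeGood (matrixOf e a.ofLp) (R ^ n) δ ∧
      LatticeGood (matrixOf e' a.ofLp) (R ^ n) δ'
  let Affine : ℕ → BobBall (EuclideanSpace ℝ (Fin M × Fin N)) → Prop := fun n b =>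
    ∀ a ∈ b.toSet, ∀ (p : Fin M → ℤ) (q : Fin N → ℤ), q ≠ 0 →
      ‖intVec q‖ ≤ γ * δ * (R ^ n) ^ M →
        δ / (4 * (R ^ n) ^ N) ≤ ‖matrixOf e a.ofLp *ᵥ intVec q + (intVec p - x.ofLp)‖ ∨
        β * (lam / (R ^ n) ^ (M + N)) * ‖intVec q‖ ≤
          ‖matrixOf e a.ofLp *ᵥ intVec q + (intVec p - x.ofLp)‖
  have hGood : ∀ n b, InWindow β r (n * K) b → Good n b →
      Forces β r (fun b' => Good (n + 1) b' ∧ Affine n b') K (n * K) b := by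
    intro n b hw hg
    have hT : 0 < R ^ n := by positivity
    have hlo : ∀ (j : ℕ) (b' : BobBall (EuclideanSpace ℝ (Fin M × Fin N))), j ≤ 2 * k →
        InWindow β r (n * K + j) b' → lam / (R ^ n) ^ (M + N) ≤ b'.radius := by
      intro j b' hj hw'
      refine le_trans ?_ hw'.1.le
      calc lam / (R ^ n) ^ (M + N) = β ^ (n * K + (2 * k + 1)) * r := by
            rw [pow_add β, hTK, hlam]; ring
        _ ≤ _ := mul_le_mul_of_nonneg_right
            (pow_le_pow_of_le_one hβ.le hβ1.le (by omega)) hr.le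
    have hhi : ∀ (j : ℕ) (b' : BobBall (EuclideanSpace ℝ (Fin M × Fin N))),
        InWindow β r (n * K + j) b' → b'.radius ≤ r / (R ^ n) ^ (M + N) := by
      intro j b' hw'
      refine hw'.2.trans ?_
      calc β ^ (n * K + j) * r ≤ β ^ (n * K) * r :=
            mul_le_mul_of_nonneg_right (pow_le_pow_of_le_one hβ.le hβ1.le (by omega)) hr.le
        _ = _ := by rw [hTK]; ring
    have step1 := forces_latticeGood e hN hr hc (fun V hV m b hw => H M N e V hV r m b hr hw)
      hlam0 hR1.le hδ0 hδ0' hT (hcR N hN) hεa hw (hlo 0 b (by omega) hw) (hhi 0 b hw)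
      (fun a ha => (hg a ha).1) (fun a ha => (hg a ha).2)
    -- The transpose is advanced from the goodness of both matrices at time R^n, which is inherited
    -- by the smaller balls.
    have step2 : Forces β r (fun b' => Good (n + 1) b' ∧ Good n b') (k + k) (n * K) b := by
      refine step1.bind hw fun b₁ hb₁ hw₁ hΦ₁ => ?_
      have h2 := forces_latticeGood e' hM hr hc (fun V hV m b hw => H N M e' V hV r m b hr hw)
        hlam0 hR1.le hδ0' hδ0 hT (hcR M hM) hεb hw₁
        (by rw [add_comm N M]; exact hlo k b₁ (by omega) hw₁)
        (by rw [add_comm N M]; exact hhi k b₁ hw₁)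
        (fun a ha => (hg a (hb₁ ha)).2) (fun a ha => (hg a (hb₁ ha)).1)
      refine h2.mono hw₁ fun b₂ hb₂ _ hΦ₂ => ⟨fun a ha => ?_, fun a ha => hg a (hb₁ (hb₂ ha))⟩
      rw [pow_succ']
      exact ⟨hΦ₁ a (hb₂ ha), hΦ₂ a ha⟩
    have step3 : Forces β r (fun b' => Good (n + 1) b' ∧ Affine n b') (k + k + 1) (n * K) b := by
      refine step2.bind hw fun b₂ _ hw₂ hΦ₂ => ?_
      refine (forces_affine hβ e hM x.ofLp hδ0 hγ0 hγ2 hγr hT (hhi _ b₂ hw₂)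
        (fun a ha => (hΦ₂.2 a ha).1)).mono hw₂ fun b₃ hb₃ _ hΦ₃ => ⟨fun a ha =>
          hΦ₂.1 a (hb₃ ha), fun a ha p q hq0 hq => ?_⟩
      refine (hΦ₃ a ha p q hq0 hq).imp id fun h => le_trans ?_ h
      have := hlo _ b₂ (by omega) hw₂
      gcongr
    refine step3.of_le hβ (fun b b' hs h => ⟨fun a ha => h.1 a (hs ha), fun a ha => h.2 a (hs ha)⟩)
      (by omega) hw
  refine ⟨K, fun n b => Good n b ∧ ∀ j, n = j + 1 → Affine j b, by omega, ?_, ?_, ?_⟩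
  · intro b _ _
    refine ⟨fun a _ => ?_, fun j hj => by omega⟩
    rw [pow_zero]
    exact ⟨latticeGood_one hδ1, latticeGood_one hδ1'⟩
  · rintro n b hw ⟨hg, -⟩
    refine (hGood n b hw hg).mono hw fun b' _ _ h => ⟨h.1, fun j hj => ?_⟩
    obtain rfl : n = j := by omega
    exact h.2
  · intro C hC y hy
    have hκ1 : γ * δ < 1 := by nlinarith
    refine mem_badSlice_of_scales hM hN (κ := γ * δ)
      (μ := min (δ / 4) (β * lam * (γ * δ) / R ^ M) / R ^ N) hR1 (by positivity) hκ1
      (div_pos (lt_min (by positivity) (by positivity)) (by positivity)) fun n p q hq0 h1 h2 => ?_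
    have e1 : ∀ t : ℝ, t / R ^ N / (R ^ n) ^ N = t / (R ^ (n + 1)) ^ N := by
      intro t
      rw [div_div, ← mul_pow, pow_succ']
    rw [e1]
    -- The upper bound for ‖q‖ is the one at time R^(n+1), whose affine bounds are recorded on the
    -- ball of index n + 2. The lower bound at scale n turns the second alternative into a bound
    -- independent of q.
    rcases (hC (n + 2)).2 (n + 1) rfl y (hy _) p q hq0 h2 with h | h
    · refine le_trans ?_ h
      rw [← div_div]
      gcongr
      exact min_le_left _ _
    · refine le_trans ?_ h
      calc min (δ / 4) (β * lam * (γ * δ) / R ^ M) / (R ^ (n + 1)) ^ N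
          ≤ β * lam * (γ * δ) / R ^ M / (R ^ (n + 1)) ^ N := by gcongr; exact min_le_right _ _
        _ = β * (lam / (R ^ (n + 1)) ^ (M + N)) * (γ * δ * (R ^ n) ^ M) := by
          rw [pow_succ]
          field_simp
          ring
        _ ≤ _ := by gcongr

end Final

end AffineForms

theorem mainTheorem5 (M N : ℕ) (hM : 1 ≤ M) (hN : 1 ≤ N) (x : EuclideanSpace ℝ (Fin M)) :
    AffineForms.IsHAW
      {a : EuclideanSpace ℝ (Fin M × Fin N) |
        AffineForms.toMatrix a ∈ AffineForms.BadSlice M N x} :=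
  ⟨1 / 3, by norm_num, le_rfl, fun _ hβ hβ' =>
    AffineForms.isBetaAbsoluteWinning_badSlice hM hN x hβ hβ'⟩
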